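/- A Čech closure operator on a set $X$ is a map $c:\mathcal P(X)\to\mathcal P(X)$ with $c(\emptyset)=\emptyset$, $A\subseteq c(A)$ and $c(A\cup B)=c(A)\cup c(B)$ for all $A,B\subseteq X$. A map $f:(X,c)\to(Y,c')$ of such closure spaces is continuous if $f(c(A))\subseteq c'(f(A))$ for all $A\subseteq X$. A set $U\subseteq X$ is a neighborhood of $x$ if $x\notin c(X\setminus U)$, and in a product $X\times Y$ the sets $U\times V$, with $U$ a neighborhood of $x$ and $V$ a neighborhood of $y$, form a local base at $(x,y)$. Let $I=[0,1]$ carry its topological closure operator. The fundamental group $\pi_1(X,x_0)$ of a closure space is the set of continuous maps $I\to X$ sending $0$ and $1$ to $x_0$, modulo homotopies $I\times I\to X$ relative to $\{0,1\}$ that are continuous on the product closure space, with the product induced by concatenation. Let $S^1=[0,1]/(0\sim1)$ carry the arc length metric $d(x,y)=\min(|x-y|,1-|x-y|)$ (total length $1$), and for a real number $r\ge 0$ let $S^1_r$ denote $S^1$ with the Čech closure operator $c_r(A)=\{x : d(x,A)\le r\}$, where $d(x,A)=\inf_{y\in A}d(x,y)$ and $d(x,\emptyset)=\infty$. **Theorem.**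 Let $r_1,r_2\ge0$, and let $X=S^1_{r_1}\vee S^1_{r_2}$ be the wedge sum of the two circles, joined at $0$, with the Čech closure operator $c_X(U)=c_{r_1}(U\cap S^1_{r_1})\cup c_{r_2}(U\cap S^1_{r_2})$ for $U\subseteq X$. Then, for every base point $x_0\in X$: 1. if $r_1<1/3$ and $r_2<1/3$, then $\pi_1(X,x_0)$ is isomorphic to the free group on two generators; 2. if $r_i<1/3$ and $r_j\ge 1/2$, where $\{i,j\}=\{1,2\}$, then $\pi_1(X,x_0)\cong\mathbb Z$; 3. if $r_1\ge1/2$ and $r_2\ge1/2$, then $\pi_1(X,x_0)$ is trivial. -/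

import Mathlib

open Set Topology
open scoped NNReal unitInterval

/-- A Čech closure operator on a set `X` (idempotence is not required). -/
@[ext]
structure CechClosure (X : Type*) where
  /-- the closure of a subset -/
  cl : Set X → Set X
  cl_empty : cl ∅ = ∅
  subset_cl : ∀ A, A ⊆ cl A
  cl_union : ∀ A B, cl (A ∪ B) = cl A ∪ cl B

namespace CechClosure

variable {X Y Z : Type*}

theorem cl_mono (c : CechClosure X) {A B : Set X} (h : A ⊆ B) : c.cl A ⊆ c.cl B := by
  have := c.cl_union A B
  rw [union_eq_self_of_subset_left h] at this
  rw [this]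
  exact subset_union_left

/-- `U` is a neighborhood of the point `x`: `x ∈ X - c (X - U)`. -/
def IsNhd (c : CechClosure X) (U : Set X) (x : X) : Prop := x ∉ c.cl Uᶜ

theorem isNhd_univ (c : CechClosure X) (x : X) : c.IsNhd univ x := by
  simp [IsNhd, c.cl_empty]

theorem IsNhd.mem {c : CechClosure X} {U : Set X} {x : X} (h : c.IsNhd U x) : x ∈ U := by
  by_contra hx
  exact h (c.subset_cl _ hx)

theorem IsNhd.mono {c : CechClosure X} {U V : Set X} {x : X} (h : c.IsNhd U x) (hUV : U ⊆ V) :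
    c.IsNhd V x :=
  fun hx => h (c.cl_mono (compl_subset_compl.2 hUV) hx)

theorem IsNhd.inter {c : CechClosure X} {U V : Set X} {x : X} (hU : c.IsNhd U x)
    (hV : c.IsNhd V x) : c.IsNhd (U ∩ V) x := by
  unfold IsNhd at *
  rw [compl_inter, c.cl_union]
  exact fun h => h.elim hU hV

theorem mem_cl_iff (c : CechClosure X) (A : Set X) (x : X) :
    x ∈ c.cl A ↔ ∀ U, c.IsNhd U x → (U ∩ A).Nonempty := by
  constructor
  · intro hx U hU
    by_contra hne
    refine hU (c.cl_mono ?_ hx)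
    intro a ha haU
    exact hne ⟨a, haU, ha⟩
  · intro h
    by_contra hx
    obtain ⟨a, ha, ha'⟩ := h Aᶜ (by simpa [IsNhd] using hx)
    exact ha ha'

/-- Continuity of a map between closure spaces: `f (c U) ⊆ c' (f U)` for every subset `U`. -/
def IsContinuous (c : CechClosure X) (d : CechClosure Y) (f : X → Y) : Prop :=
  ∀ U : Set X, f '' c.cl U ⊆ d.cl (f '' U)

theorem isContinuous_iff {c : CechClosure X} {d : CechClosure Y} {f : X → Y} :
    c.IsContinuous d f ↔ ∀ x U, d.IsNhd U (f x) → c.IsNhd (f ⁻¹' U) x := by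
  constructor
  · intro h x U hU hx
    refine hU (d.cl_mono ?_ (h _ ⟨x, hx, rfl⟩))
    rintro _ ⟨y, hy, rfl⟩
    exact hy
  · rintro h A _ ⟨x, hx, rfl⟩
    rw [mem_cl_iff] at hx ⊢
    intro U hU
    obtain ⟨a, ha, haA⟩ := hx _ (h x U hU)
    exact ⟨f a, ha, a, haA, rfl⟩

/-- The closure operator of a topological space. -/
def ofTopology (X : Type*) [TopologicalSpace X] : CechClosure X where
  cl := closure
  cl_empty := closure_empty
  subset_cl _ := subset_closure
  cl_union _ _ := closure_union

theorem isNhd_ofTopology [TopologicalSpace X] {U : Set X} {x : X} :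
    (ofTopology X).IsNhd U x ↔ U ∈ 𝓝 x := by
  change x ∉ closure Uᶜ ↔ _
  rw [closure_compl, mem_compl_iff, not_not, mem_interior_iff_mem_nhds]

/-- The product of two closure spaces: the sets `U × V`, with `U` a neighborhood of `x` and `V` a
neighborhood of `y`, form a local base at `(x, y)`. -/
def prod (c : CechClosure X) (d : CechClosure Y) : CechClosure (X × Y) where
  cl A := {p | ∀ U V, c.IsNhd U p.1 → d.IsNhd V p.2 → ((U ×ˢ V) ∩ A).Nonempty}
  cl_empty := by
    ext p
    simp only [mem_ofPred_eq, inter_empty, mem_empty_iff_false, iff_false]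
    intro h
    exact not_nonempty_empty (h univ univ (c.isNhd_univ _) (d.isNhd_univ _))
  subset_cl A p hp U V hU hV := ⟨p, ⟨hU.mem, hV.mem⟩, hp⟩
  cl_union A B := by
    ext p
    constructor
    · intro h
      by_contra hn
      simp only [mem_union, mem_ofPred_eq, not_or, not_forall] at hn
      obtain ⟨⟨U, V, hU, hV, hA⟩, U', V', hU', hV', hB⟩ := hn
      obtain ⟨q, hq, hqA | hqB⟩ := h _ _ (hU.inter hU') (hV.inter hV')
      · exact hA ⟨q, ⟨hq.1.1, hq.2.1⟩, hqA⟩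
      · exact hB ⟨q, ⟨hq.1.2, hq.2.2⟩, hqB⟩
    · rintro (h | h) U V hU hV
      · exact (h U V hU hV).mono (inter_subset_inter_right _ subset_union_left)
      · exact (h U V hU hV).mono (inter_subset_inter_right _ subset_union_right)

theorem isNhd_prod {c : CechClosure X} {d : CechClosure Y} {W : Set (X × Y)} {p : X × Y} :
    (c.prod d).IsNhd W p ↔ ∃ U V, c.IsNhd U p.1 ∧ d.IsNhd V p.2 ∧ U ×ˢ V ⊆ W := by
  change (¬ ∀ U V, c.IsNhd U p.1 → d.IsNhd V p.2 → ((U ×ˢ V) ∩ Wᶜ).Nonempty) ↔ _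
  simp only [not_forall, not_nonempty_iff_eq_empty, exists_prop, ← sdiff_eq,
    sdiff_eq_empty]

theorem isNhd_prod_ofTopology [TopologicalSpace X] [TopologicalSpace Y] {W : Set (X × Y)}
    {p : X × Y} : ((ofTopology X).prod (ofTopology Y)).IsNhd W p ↔ W ∈ 𝓝 p := by
  rw [isNhd_prod, mem_nhds_prod_iff]
  simp only [isNhd_ofTopology]
  grind

/-- The closure operator `c_r (A) = {x | d (x, A) ≤ r}` of a metric space; the distance to the
empty set is infinite. -/
noncomputable def ofMetric (X : Type*) [MetricSpace X] (r : ℝ≥0) : CechClosure X where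
  cl A := {x | Metric.infEDist x A ≤ r}
  cl_empty := by ext x; simp
  subset_cl A x hx := by simp [Metric.infEDist_zero_of_mem hx]
  cl_union A B := by ext x; simp [Metric.infEDist_union]

end CechClosure

/-! ### The fundamental group -/

namespace CechClosure

variable {X Y : Type*} {c : CechClosure X} {x₀ : X}

theorem isContinuous_ofTopology_iff [TopologicalSpace Y] {f : Y → X} :
    (ofTopology Y).IsContinuous c f ↔ ∀ y U, c.IsNhd U (f y) → f ⁻¹' U ∈ 𝓝 y := by
  simp only [isContinuous_iff, isNhd_ofTopology]

theorem isContinuous_prod_iff {A B : Type*} [TopologicalSpace A] [TopologicalSpace B]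
    {f : A × B → X} :
    ((ofTopology A).prod (ofTopology B)).IsContinuous c f ↔
      (ofTopology (A × B)).IsContinuous c f := by
  simp only [isContinuous_iff, isNhd_prod_ofTopology, isNhd_ofTopology]

theorem IsContinuous.comp_continuous {A B : Type*} [TopologicalSpace A] [TopologicalSpace B]
    {f : B → X} {g : A → B} (hf : (ofTopology B).IsContinuous c f) (hg : Continuous g) :
    (ofTopology A).IsContinuous c (fun a => f (g a)) := by
  rw [isContinuous_ofTopology_iff] at *
  intro y U hU
  exact hg.continuousAt (hf (g y) U hU)

theorem isContinuous_const [TopologicalSpace Y] (x : X) :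
    (ofTopology Y).IsContinuous c (fun _ => x) := by
  rw [isContinuous_ofTopology_iff]
  intro y U hU
  simp [hU.mem]

theorem IsContinuous.ite_le [TopologicalSpace Y] {f g : Y → X} {u v : Y → ℝ}
    (hf : (ofTopology Y).IsContinuous c f) (hg : (ofTopology Y).IsContinuous c g)
    (hu : Continuous u) (hv : Continuous v) (h : ∀ y, u y = v y → f y = g y) :
    (ofTopology Y).IsContinuous c (fun y => if u y ≤ v y then f y else g y) := by
  rw [isContinuous_ofTopology_iff] at *
  intro y U hU
  rcases lt_trichotomy (u y) (v y) with hlt | heq | hgt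
  · rw [if_pos hlt.le] at hU
    filter_upwards [hf y U hU, (hu.tendsto y).eventually_lt (hv.tendsto y) hlt] with z hz hz'
    simpa [hz'.le] using hz
  · rw [if_pos heq.le] at hU
    filter_upwards [hf y U hU, hg y U (h y heq ▸ hU)] with z hz hz'
    by_cases hc : u z ≤ v z
    · simpa [hc] using hz
    · simpa [hc] using hz'
  · rw [if_neg hgt.not_ge] at hU
    filter_upwards [hg y U hU, (hv.tendsto y).eventually_lt (hu.tendsto y) hgt] with z hz hz'
    simpa [hz'.not_ge] using hz

/-- A loop at `x₀`: a continuous map from `[0,1]`, with its topological closure operator, sending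
both endpoints to `x₀`. -/
structure Loop (c : CechClosure X) (x₀ : X) where
  /-- the underlying map -/
  toFun : I → X
  cont : (ofTopology I).IsContinuous c toFun
  source : toFun 0 = x₀
  target : toFun 1 = x₀

namespace Loop

/-- Homotopy of loops relative to the endpoints, through continuous maps on the product closure
space `I × I`; the second coordinate is the homotopy parameter. -/
def Homotopic (f g : Loop c x₀) : Prop :=
  ∃ H : I × I → X, ((ofTopology I).prod (ofTopology I)).IsContinuous c H ∧
    (∀ s, H (s, 0) = f.toFun s) ∧ (∀ s, H (s, 1) = g.toFun s) ∧
    (∀ t, H (0, t) = x₀) ∧ (∀ t, H (1, t) = x₀)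

/-- Extension of a loop to the real line, constant outside `[0,1]`. -/
noncomputable def extend (f : Loop c x₀) : ℝ → X := IccExtend zero_le_one f.toFun

theorem extend_cont (f : Loop c x₀) : (ofTopology ℝ).IsContinuous c f.extend :=
  f.cont.comp_continuous (continuous_projIcc (h := zero_le_one))

theorem extend_of_le_zero (f : Loop c x₀) {t : ℝ} (ht : t ≤ 0) : f.extend t = x₀ := by
  rw [extend, IccExtend_of_le_left _ _ ht]
  exact f.source

theorem extend_of_one_le (f : Loop c x₀) {t : ℝ} (ht : 1 ≤ t) : f.extend t = x₀ := by
  rw [extend, IccExtend_of_right_le _ _ ht]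
  exact f.target

theorem extend_coe (f : Loop c x₀) (t : I) : f.extend t = f.toFun t :=
  IccExtend_val _ _ _

/-- The constant loop. -/
def const (c : CechClosure X) (x₀ : X) : Loop c x₀ where
  toFun _ := x₀
  cont := isContinuous_const x₀
  source := rfl
  target := rfl

/-- The reversed loop. -/
def rev (f : Loop c x₀) : Loop c x₀ where
  toFun t := f.toFun (σ t)
  cont := f.cont.comp_continuous unitInterval.continuous_symm
  source := by simp [f.target]
  target := by simp [f.source]

/-- The concatenation: `f (2t)` for `t ≤ 1/2` and `g (2t - 1)` for `t > 1/2`. -/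
noncomputable def trans (f g : Loop c x₀) : Loop c x₀ where
  toFun t := if (t : ℝ) ≤ 1 / 2 then f.extend (2 * t) else g.extend (2 * t - 1)
  cont := by
    refine IsContinuous.ite_le (u := fun t : I => (t : ℝ)) (v := fun _ => 1 / 2)
      (f.extend_cont.comp_continuous (by fun_prop))
      (g.extend_cont.comp_continuous (by fun_prop)) (by fun_prop) (by fun_prop) ?_
    intro t ht
    rw [f.extend_of_one_le (by linarith), g.extend_of_le_zero (by linarith)]
  source := by
    rw [if_pos (by simp)]
    exact f.extend_of_le_zero (by simp)
  target := by
    rw [if_neg (by norm_num)]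
    exact g.extend_of_one_le (by norm_num)

theorem homotopic_of_comp {F : ℝ → X} (hF : (ofTopology ℝ).IsContinuous c F) {φ ψ : I → ℝ}
    (hφ : Continuous φ) (hψ : Continuous ψ) (h0 : φ 0 = ψ 0) (h1 : φ 1 = ψ 1)
    {f g : Loop c x₀} (hf : ∀ t, f.toFun t = F (φ t)) (hg : ∀ t, g.toFun t = F (ψ t)) :
    f.Homotopic g := by
  refine ⟨fun p => F ((1 - p.2) * φ p.1 + p.2 * ψ p.1), ?_, ?_, ?_, ?_, ?_⟩
  · rw [isContinuous_prod_iff]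
    exact hF.comp_continuous (by fun_prop)
  · intro s; simp [hf]
  · intro s; simp [hg]
  · intro t
    have : (1 - (t : ℝ)) * φ 0 + t * ψ 0 = φ 0 := by rw [← h0]; ring
    simp only [this, ← hf, f.source]
  · intro t
    have : (1 - (t : ℝ)) * φ 1 + t * ψ 1 = φ 1 := by rw [← h1]; ring
    simp only [this, ← hf, f.target]

theorem Homotopic.refl (f : Loop c x₀) : f.Homotopic f :=
  homotopic_of_comp f.extend_cont (φ := fun t => t) (ψ := fun t => t) (by fun_prop)
    (by fun_prop) rfl rfl (fun t => (f.extend_coe t).symm) (fun t => (f.extend_coe t).symm)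

theorem Homotopic.symm {f g : Loop c x₀} (h : f.Homotopic g) : g.Homotopic f := by
  obtain ⟨H, hH, h0, h1, ha, hb⟩ := h
  rw [isContinuous_prod_iff] at hH
  refine ⟨fun p => H (p.1, σ p.2), ?_, ?_, ?_, ?_, ?_⟩
  · rw [isContinuous_prod_iff]
    exact hH.comp_continuous (by fun_prop)
  all_goals simp [*]

theorem Homotopic.trans {f g h : Loop c x₀} (hfg : f.Homotopic g) (hgh : g.Homotopic h) :
    f.Homotopic h := by
  obtain ⟨H, hH, h0, h1, ha, hb⟩ := hfg
  obtain ⟨K, hK, k0, k1, ka, kb⟩ := hgh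
  rw [isContinuous_prod_iff] at hH hK
  refine ⟨fun p => if (p.2 : ℝ) ≤ 1 / 2 then H (p.1, projIcc 0 1 zero_le_one (2 * p.2))
    else K (p.1, projIcc 0 1 zero_le_one (2 * p.2 - 1)), ?_, ?_, ?_, ?_, ?_⟩
  · rw [isContinuous_prod_iff]
    refine IsContinuous.ite_le (u := fun p : I × I => (p.2 : ℝ)) (v := fun _ => 1 / 2)
      (hH.comp_continuous
        (continuous_fst.prodMk (continuous_projIcc.comp (by fun_prop))))
      (hK.comp_continuous
        (continuous_fst.prodMk (continuous_projIcc.comp (by fun_prop))))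
      (by fun_prop) (by fun_prop) ?_
    intro p hp
    rw [projIcc_of_right_le _ (by linarith), projIcc_of_le_left _ (by linarith)]
    exact (h1 _).trans (k0 _).symm
  · intro s
    simp only
    rw [if_pos (by simp), projIcc_of_le_left _ (by simp)]
    exact h0 s
  · intro s
    simp only
    rw [if_neg (by norm_num), projIcc_of_right_le _ (by norm_num)]
    exact k1 s
  · intro t; simp only [ha, ka, ite_self]
  · intro t; simp only [hb, kb, ite_self]

theorem Homotopic.trans_congr {f f' g g' : Loop c x₀} (hf : f.Homotopic f')
    (hg : g.Homotopic g') : (f.trans g).Homotopic (f'.trans g') := by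
  obtain ⟨H, hH, h0, h1, ha, hb⟩ := hf
  obtain ⟨K, hK, k0, k1, ka, kb⟩ := hg
  rw [isContinuous_prod_iff] at hH hK
  refine ⟨fun p => if (p.1 : ℝ) ≤ 1 / 2 then H (projIcc 0 1 zero_le_one (2 * p.1), p.2)
    else K (projIcc 0 1 zero_le_one (2 * p.1 - 1), p.2), ?_, ?_, ?_, ?_, ?_⟩
  · rw [isContinuous_prod_iff]
    refine IsContinuous.ite_le (u := fun p : I × I => (p.1 : ℝ)) (v := fun _ => 1 / 2)
      (hH.comp_continuous
        ((continuous_projIcc.comp (by fun_prop)).prodMk continuous_snd))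
      (hK.comp_continuous
        ((continuous_projIcc.comp (by fun_prop)).prodMk continuous_snd))
      (by fun_prop) (by fun_prop) ?_
    intro p hp
    rw [projIcc_of_right_le _ (by linarith), projIcc_of_le_left _ (by linarith)]
    exact (hb _).trans (ka _).symm
  · intro s; simp only [h0, k0]; rfl
  · intro s; simp only [h1, k1]; rfl
  · intro t
    simp only
    rw [if_pos (by simp), projIcc_of_le_left _ (by simp)]
    exact ha t
  · intro t
    simp only
    rw [if_neg (by norm_num), projIcc_of_right_le _ (by norm_num)]
    exact kb t

theorem Homotopic.rev_congr {f g : Loop c x₀} (h : f.Homotopic g) : f.rev.Homotopic g.rev := by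
  obtain ⟨H, hH, h0, h1, ha, hb⟩ := h
  rw [isContinuous_prod_iff] at hH
  refine ⟨fun p => H (σ p.1, p.2), ?_, ?_, ?_, ?_, ?_⟩
  · rw [isContinuous_prod_iff]
    exact hH.comp_continuous (by fun_prop)
  all_goals simp [*, rev]

theorem const_trans (f : Loop c x₀) : ((const c x₀).trans f).Homotopic f := by
  refine homotopic_of_comp f.extend_cont (φ := fun t => max (2 * t - 1) 0) (ψ := fun t => t)
    (by fun_prop) (by fun_prop) (by norm_num) (by norm_num) ?_
    (fun t => (f.extend_coe t).symm)
  intro t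
  simp only [trans]
  split_ifs with h
  · rw [max_eq_right (by linarith), f.extend_of_le_zero le_rfl]
    rfl
  · rw [max_eq_left (by linarith)]

theorem trans_const (f : Loop c x₀) : (f.trans (const c x₀)).Homotopic f := by
  refine homotopic_of_comp f.extend_cont (φ := fun t => min (2 * t) 1) (ψ := fun t => t)
    (by fun_prop) (by fun_prop) (by norm_num) (by norm_num) ?_
    (fun t => (f.extend_coe t).symm)
  intro t
  simp only [trans]
  split_ifs with h
  · rw [min_eq_left (by linarith)]
  · rw [min_eq_right (by linarith), f.extend_of_one_le le_rfl]
    rfl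

theorem extend_rev (f : Loop c x₀) (t : ℝ) : f.rev.extend t = f.extend (1 - t) := by
  rcases le_total t 0 with h | h
  · rw [extend_of_le_zero _ h, extend_of_one_le _ (by linarith)]
  rcases le_total 1 t with h' | h'
  · rw [extend_of_one_le _ h', extend_of_le_zero _ (by linarith)]
  · have h1 := f.rev.extend_coe ⟨t, h, h'⟩
    have h2 := f.extend_coe (σ ⟨t, h, h'⟩)
    exact h1.trans h2.symm

theorem rev_trans (f : Loop c x₀) : (f.rev.trans f).Homotopic (const c x₀) := by
  refine homotopic_of_comp f.extend_cont (φ := fun t => |2 * t - 1|) (ψ := fun _ => 1)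
    (by fun_prop) (by fun_prop) (by norm_num) (by norm_num) ?_
    (fun t => (f.extend_of_one_le le_rfl).symm)
  intro t
  simp only [trans]
  split_ifs with h
  · rw [extend_rev, abs_of_nonpos (by linarith)]
    congr 1
    ring
  · rw [abs_of_nonneg (by linarith)]

theorem trans_assoc (f g h : Loop c x₀) :
    ((f.trans g).trans h).Homotopic (f.trans (g.trans h)) := by
  have ext : ∀ (a b : Loop c x₀) (t : ℝ), (a.trans b).extend t =
      if t ≤ 1 / 2 then a.extend (2 * t) else b.extend (2 * t - 1) := by
    intro a b t
    rcases le_total t 0 with h | h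
    · rw [extend_of_le_zero _ h, if_pos (by linarith), extend_of_le_zero _ (by linarith)]
    rcases le_total 1 t with h' | h'
    · rw [extend_of_one_le _ h', if_neg (by linarith), extend_of_one_le _ (by linarith)]
    · exact (a.trans b).extend_coe ⟨t, h, h'⟩
  have hF : (ofTopology ℝ).IsContinuous c
      (fun t => if t ≤ 1 then f.extend t else (if t ≤ 2 then g.extend (t - 1)
        else h.extend (t - 2))) := by
    refine IsContinuous.ite_le (u := fun t : ℝ => t) (v := fun _ => 1) f.extend_cont
      (IsContinuous.ite_le (u := fun t : ℝ => t) (v := fun _ => 2)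
        (g.extend_cont.comp_continuous (by fun_prop))
        (h.extend_cont.comp_continuous (by fun_prop)) (by fun_prop) (by fun_prop) ?_)
        (by fun_prop) (by fun_prop) ?_
    · intro t ht
      rw [g.extend_of_one_le (by linarith), h.extend_of_le_zero (by linarith)]
    · intro t ht
      rw [f.extend_of_one_le (by linarith), if_pos (by linarith),
        g.extend_of_le_zero (by linarith)]
  refine homotopic_of_comp hF (φ := fun t => min (4 * t) (2 * t + 1))
    (ψ := fun t => max (2 * t) (4 * t - 1))
    (by fun_prop) (by fun_prop) (by norm_num) (by norm_num) ?_ ?_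
  · intro t
    change (if (t : ℝ) ≤ 1 / 2 then (f.trans g).extend (2 * t) else h.extend (2 * t - 1)) = _
    rw [ext]
    rcases le_or_gt (t : ℝ) (1 / 2) with h2 | h2
    · rw [if_pos h2, min_eq_left (by linarith)]
      rcases le_or_gt (t : ℝ) (1 / 4) with h4 | h4
      · rw [if_pos (by linarith), if_pos (by linarith)]
        congr 1
        ring
      · rw [if_neg (by linarith), if_neg (by linarith), if_pos (by linarith)]
        congr 1
        ring
    · rw [if_neg h2.not_ge, min_eq_right (by linarith), if_neg (by linarith),
        if_neg (by linarith)]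
      congr 1
      ring
  · intro t
    change (if (t : ℝ) ≤ 1 / 2 then f.extend (2 * t) else (g.trans h).extend (2 * t - 1)) = _
    rw [ext]
    rcases le_or_gt (t : ℝ) (1 / 2) with h2 | h2
    · rw [if_pos h2, max_eq_left (by linarith), if_pos (by linarith)]
    · rw [if_neg h2.not_ge, max_eq_right (by linarith)]
      rcases le_or_gt (t : ℝ) (3 / 4) with h4 | h4
      · rw [if_pos (by linarith), if_neg (by linarith), if_pos (by linarith)]
        congr 1
        ring
      · rw [if_neg (by linarith), if_neg (by linarith), if_neg (by linarith)]
        congr 1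
        ring

instance setoid (c : CechClosure X) (x₀ : X) : Setoid (Loop c x₀) where
  r := Homotopic
  iseqv := ⟨Homotopic.refl, Homotopic.symm, Homotopic.trans⟩

end Loop

/-- The fundamental group of a closure space at the base point `x₀`: homotopy classes of loops
relative to the endpoints. -/
def FundamentalGroup (c : CechClosure X) (x₀ : X) : Type _ := Quotient (Loop.setoid c x₀)

/-- The product of classes is `[f][g] = [f ⋆ g]`. -/
noncomputable instance (c : CechClosure X) (x₀ : X) : Group (FundamentalGroup c x₀) where
  mul := Quotient.map₂ Loop.trans fun _ _ h _ _ h' => Loop.Homotopic.trans_congr h h'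
  one := Quotient.mk _ (Loop.const c x₀)
  inv := Quotient.map Loop.rev fun _ _ h => Loop.Homotopic.rev_congr h
  mul_assoc := by
    rintro ⟨f⟩ ⟨g⟩ ⟨h⟩
    exact Quotient.sound (Loop.trans_assoc f g h)
  one_mul := by
    rintro ⟨f⟩
    exact Quotient.sound (Loop.const_trans f)
  mul_one := by
    rintro ⟨f⟩
    exact Quotient.sound (Loop.trans_const f)
  inv_mul_cancel := by
    rintro ⟨f⟩
    exact Quotient.sound (Loop.rev_trans f)

end CechClosure

/-! ### Wedge sums -/

/-- The identification of the two base points in a disjoint union. -/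
inductive WedgeRel {X Y : Type*} (x : X) (y : Y) : X ⊕ Y → X ⊕ Y → Prop
  | glue : WedgeRel x y (Sum.inl x) (Sum.inr y)

/-- The wedge sum of the pointed sets `(X, x)` and `(Y, y)`: the quotient of the disjoint union
by the equivalence relation generated by `x ∼ y`. -/
def Wedge {X Y : Type*} (x : X) (y : Y) : Type _ := Quot (WedgeRel x y)

namespace Wedge

variable {X Y : Type*} {x : X} {y : Y}

/-- The inclusion of the first summand. -/
def inl (a : X) : Wedge x y := Quot.mk _ (Sum.inl a)

/-- The inclusion of the second summand. -/
def inr (b : Y) : Wedge x y := Quot.mk _ (Sum.inr b)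

/-- The closure operator `U ↦ c (U ∩ X) ∪ d (U ∩ Y)` on the wedge sum of two closure spaces. -/
def closure (c : CechClosure X) (d : CechClosure Y) (x : X) (y : Y) :
    CechClosure (Wedge x y) where
  cl U := inl '' c.cl (inl ⁻¹' U) ∪ inr '' d.cl (inr ⁻¹' U)
  cl_empty := by simp [c.cl_empty, d.cl_empty]
  subset_cl := by
    rintro U ⟨a | b⟩ h
    · exact Or.inl ⟨a, c.subset_cl _ h, rfl⟩
    · exact Or.inr ⟨b, d.subset_cl _ h, rfl⟩
  cl_union A B := by
    simp only [preimage_union, c.cl_union, d.cl_union, image_union]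
    exact union_union_union_comm _ _ _ _

end Wedge

/-- The wedge of two circles of circumference `1` (with the arc length metric, that is, `ℝ / ℤ`),
joined at `0`. -/
abbrev WedgeOfCircles : Type := Wedge (0 : UnitAddCircle) (0 : UnitAddCircle)

/-- The closure operator on the wedge of two circles induced by `c_{r₁}` on the first circle and
`c_{r₂}` on the second circle. -/
noncomputable def wedgeOfCirclesClosure (r₁ r₂ : ℝ≥0) : CechClosure WedgeOfCircles :=
  Wedge.closure (CechClosure.ofMetric UnitAddCircle r₁) (CechClosure.ofMetric UnitAddCircle r₂) 0 0

/-! The group is computed by measuring a curve with a locally defined winding cocycle, and by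
showing that this measurement determines the homotopy class.

A map into the wedge is continuous when nearby parameters go to points at distance less than ρ on a
common circle, for all radii ρ above `r`. When `r i < 1/3`, take ρ = 1/3: for three points pairwise
closer than 1/3, the short displacements sum without wrapping around, so the integers `wind` add up
(`wind_add_wind`). When `1/2 ≤ r i`, the radius covers the diameter 1/2, every map into that circle
is continuous, and its loop is trivial (`loop_eq_one`). Giving each small circle a generator of `G`,
and each large one the element 1, yields a `G`-valued cocycle on the balls (`isCocycle_transition`).

A cocycle pulled back to a simply connected domain defines a covering with fiber `G`, and the
identity lifts to it (`IsLocalCocycle.exists_isLocalLift`). Lifting over the line gives the degree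
of a curve, and lifting over the plane shows that degree is a homotopy invariant. Conversely, a
curve inside a ball contracts to a short arc (`cls_eq_arc`), so its class, closed up by arcs from
the base point, is the power of the loop prescribed by the cocycle (`conj_cls_eq`). Subdividing,
which is again uniqueness of lifts, extends this to all curves (`IsCocycle.conj_eq`). Hence degree
is injective on loops, and surjective because the standard loops have the generators as degrees
(`deg_loop`). The group `G` is free on two generators, infinite cyclic or trivial. The pieces of a
loop are not loops, so the argument runs in the fundamental groupoid. -/

namespace CechClosure

/-! ### The fundamental groupoid of a closure space -/

open CategoryTheory

variable {X Y : Type*} {c : CechClosure X} {x y z : X}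

/-- A curve from `x` to `y`: a continuous map from `[0,1]`, with its topological closure operator,
sending `0` to `x` and `1` to `y`. -/
structure Curve (c : CechClosure X) (x y : X) where
  /-- the underlying map -/
  toFun : I → X
  cont : (ofTopology I).IsContinuous c toFun
  source : toFun 0 = x
  target : toFun 1 = y

namespace Curve

/-- Homotopy of curves relative to the endpoints, through continuous maps on the product closure
space `I × I`; the second coordinate is the homotopy parameter. -/
def Homotopic (f g : Curve c x y) : Prop :=
  ∃ H : I × I → X, ((ofTopology I).prod (ofTopology I)).IsContinuous c H ∧
    (∀ s, H (s, 0) = f.toFun s) ∧ (∀ s, H (s, 1) = g.toFun s) ∧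
    (∀ t, H (0, t) = x) ∧ (∀ t, H (1, t) = y)

/-- Extension of a curve to the real line, constant outside `[0,1]`. -/
noncomputable def extend (f : Curve c x y) : ℝ → X := IccExtend zero_le_one f.toFun

theorem extend_cont (f : Curve c x y) : (ofTopology ℝ).IsContinuous c f.extend :=
  f.cont.comp_continuous (continuous_projIcc (h := zero_le_one))

theorem extend_of_le_zero (f : Curve c x y) {t : ℝ} (ht : t ≤ 0) : f.extend t = x := by
  rw [extend, IccExtend_of_le_left _ _ ht]
  exact f.source

theorem extend_of_one_le (f : Curve c x y) {t : ℝ} (ht : 1 ≤ t) : f.extend t = y := by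
  rw [extend, IccExtend_of_right_le _ _ ht]
  exact f.target

theorem extend_coe (f : Curve c x y) (t : I) : f.extend t = f.toFun t :=
  IccExtend_val _ _ _

/-- The constant curve. -/
def const (c : CechClosure X) (x : X) : Curve c x x where
  toFun _ := x
  cont := isContinuous_const x
  source := rfl
  target := rfl

/-- The reversed curve. -/
def rev (f : Curve c x y) : Curve c y x where
  toFun t := f.toFun (σ t)
  cont := f.cont.comp_continuous unitInterval.continuous_symm
  source := by simp [f.target]
  target := by simp [f.source]

/-- The concatenation: `f (2t)` for `t ≤ 1/2` and `g (2t - 1)` for `t > 1/2`. -/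
noncomputable def trans (f : Curve c x y) (g : Curve c y z) : Curve c x z where
  toFun t := if (t : ℝ) ≤ 1 / 2 then f.extend (2 * t) else g.extend (2 * t - 1)
  cont := by
    refine IsContinuous.ite_le (u := fun t : I => (t : ℝ)) (v := fun _ => 1 / 2)
      (f.extend_cont.comp_continuous (by fun_prop))
      (g.extend_cont.comp_continuous (by fun_prop)) (by fun_prop) (by fun_prop) ?_
    intro t ht
    rw [f.extend_of_one_le (by linarith), g.extend_of_le_zero (by linarith)]
  source := by
    rw [if_pos (by simp)]
    exact f.extend_of_le_zero (by simp)
  target := by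
    rw [if_neg (by norm_num)]
    exact g.extend_of_one_le (by norm_num)

/-- The straight-line homotopy from `φ` to `ψ` takes place in the real line, where it is continuous,
and is then pushed forward by `F`. Unit, inverse and associativity laws all reduce to it, since both
sides reparametrize one map. -/
theorem homotopic_of_comp {F : ℝ → X} (hF : (ofTopology ℝ).IsContinuous c F) {φ ψ : I → ℝ}
    (hφ : Continuous φ) (hψ : Continuous ψ) (h0 : φ 0 = ψ 0) (h1 : φ 1 = ψ 1)
    {f g : Curve c x y} (hf : ∀ t, f.toFun t = F (φ t)) (hg : ∀ t, g.toFun t = F (ψ t)) :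
    f.Homotopic g := by
  refine ⟨fun p => F ((1 - p.2) * φ p.1 + p.2 * ψ p.1), ?_, ?_, ?_, ?_, ?_⟩
  · rw [isContinuous_prod_iff]
    exact hF.comp_continuous (by fun_prop)
  · intro s; simp [hf]
  · intro s; simp [hg]
  · intro t
    have : (1 - (t : ℝ)) * φ 0 + t * ψ 0 = φ 0 := by rw [← h0]; ring
    simp only [this, ← hf, f.source]
  · intro t
    have : (1 - (t : ℝ)) * φ 1 + t * ψ 1 = φ 1 := by rw [← h1]; ring
    simp only [this, ← hf, f.target]

theorem Homotopic.refl (f : Curve c x y) : f.Homotopic f :=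
  homotopic_of_comp f.extend_cont (φ := fun t => t) (ψ := fun t => t) (by fun_prop)
    (by fun_prop) rfl rfl (fun t => (f.extend_coe t).symm) (fun t => (f.extend_coe t).symm)

theorem Homotopic.symm {f g : Curve c x y} (h : f.Homotopic g) : g.Homotopic f := by
  obtain ⟨H, hH, h0, h1, ha, hb⟩ := h
  rw [isContinuous_prod_iff] at hH
  refine ⟨fun p => H (p.1, σ p.2), ?_, ?_, ?_, ?_, ?_⟩
  · rw [isContinuous_prod_iff]
    exact hH.comp_continuous (by fun_prop)
  all_goals simp [*]

theorem Homotopic.trans {f g h : Curve c x y} (hfg : f.Homotopic g) (hgh : g.Homotopic h) :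
    f.Homotopic h := by
  obtain ⟨H, hH, h0, h1, ha, hb⟩ := hfg
  obtain ⟨K, hK, k0, k1, ka, kb⟩ := hgh
  rw [isContinuous_prod_iff] at hH hK
  refine ⟨fun p => if (p.2 : ℝ) ≤ 1 / 2 then H (p.1, projIcc 0 1 zero_le_one (2 * p.2))
    else K (p.1, projIcc 0 1 zero_le_one (2 * p.2 - 1)), ?_, ?_, ?_, ?_, ?_⟩
  · rw [isContinuous_prod_iff]
    refine IsContinuous.ite_le (u := fun p : I × I => (p.2 : ℝ)) (v := fun _ => 1 / 2)
      (hH.comp_continuous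
        (continuous_fst.prodMk (continuous_projIcc.comp (by fun_prop))))
      (hK.comp_continuous
        (continuous_fst.prodMk (continuous_projIcc.comp (by fun_prop))))
      (by fun_prop) (by fun_prop) ?_
    intro p hp
    rw [projIcc_of_right_le _ (by linarith), projIcc_of_le_left _ (by linarith)]
    exact (h1 _).trans (k0 _).symm
  · intro s
    simp only
    rw [if_pos (by simp), projIcc_of_le_left _ (by simp)]
    exact h0 s
  · intro s
    simp only
    rw [if_neg (by norm_num), projIcc_of_right_le _ (by norm_num)]
    exact k1 s
  · intro t; simp only [ha, ka, ite_self]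
  · intro t; simp only [hb, kb, ite_self]

theorem Homotopic.trans_congr {f f' : Curve c x y} {g g' : Curve c y z} (hf : f.Homotopic f')
    (hg : g.Homotopic g') : (f.trans g).Homotopic (f'.trans g') := by
  obtain ⟨H, hH, h0, h1, ha, hb⟩ := hf
  obtain ⟨K, hK, k0, k1, ka, kb⟩ := hg
  rw [isContinuous_prod_iff] at hH hK
  refine ⟨fun p => if (p.1 : ℝ) ≤ 1 / 2 then H (projIcc 0 1 zero_le_one (2 * p.1), p.2)
    else K (projIcc 0 1 zero_le_one (2 * p.1 - 1), p.2), ?_, ?_, ?_, ?_, ?_⟩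
  · rw [isContinuous_prod_iff]
    refine IsContinuous.ite_le (u := fun p : I × I => (p.1 : ℝ)) (v := fun _ => 1 / 2)
      (hH.comp_continuous
        ((continuous_projIcc.comp (by fun_prop)).prodMk continuous_snd))
      (hK.comp_continuous
        ((continuous_projIcc.comp (by fun_prop)).prodMk continuous_snd))
      (by fun_prop) (by fun_prop) ?_
    intro p hp
    rw [projIcc_of_right_le _ (by linarith), projIcc_of_le_left _ (by linarith)]
    exact (hb _).trans (ka _).symm
  · intro s; simp only [h0, k0]; rfl
  · intro s; simp only [h1, k1]; rfl
  · intro t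
    simp only
    rw [if_pos (by simp), projIcc_of_le_left _ (by simp)]
    exact ha t
  · intro t
    simp only
    rw [if_neg (by norm_num), projIcc_of_right_le _ (by norm_num)]
    exact kb t

theorem Homotopic.rev_congr {f g : Curve c x y} (h : f.Homotopic g) : f.rev.Homotopic g.rev := by
  obtain ⟨H, hH, h0, h1, ha, hb⟩ := h
  rw [isContinuous_prod_iff] at hH
  refine ⟨fun p => H (σ p.1, p.2), ?_, ?_, ?_, ?_, ?_⟩
  · rw [isContinuous_prod_iff]
    exact hH.comp_continuous (by fun_prop)
  all_goals simp [*, rev]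

theorem const_trans (f : Curve c x y) : ((const c x).trans f).Homotopic f := by
  refine homotopic_of_comp f.extend_cont (φ := fun t => max (2 * t - 1) 0) (ψ := fun t => t)
    (by fun_prop) (by fun_prop) (by norm_num) (by norm_num) ?_
    (fun t => (f.extend_coe t).symm)
  intro t
  simp only [trans]
  split_ifs with h
  · rw [max_eq_right (by linarith), f.extend_of_le_zero le_rfl]
    rfl
  · rw [max_eq_left (by linarith)]

theorem trans_const (f : Curve c x y) : (f.trans (const c y)).Homotopic f := by
  refine homotopic_of_comp f.extend_cont (φ := fun t => min (2 * t) 1) (ψ := fun t => t)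
    (by fun_prop) (by fun_prop) (by norm_num) (by norm_num) ?_
    (fun t => (f.extend_coe t).symm)
  intro t
  simp only [trans]
  split_ifs with h
  · rw [min_eq_left (by linarith)]
  · rw [min_eq_right (by linarith), f.extend_of_one_le le_rfl]
    rfl

theorem extend_rev (f : Curve c x y) (t : ℝ) : f.rev.extend t = f.extend (1 - t) := by
  rcases le_total t 0 with h | h
  · rw [extend_of_le_zero _ h, extend_of_one_le _ (by linarith)]
  rcases le_total 1 t with h' | h'
  · rw [extend_of_one_le _ h', extend_of_le_zero _ (by linarith)]
  · have h1 := f.rev.extend_coe ⟨t, h, h'⟩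
    have h2 := f.extend_coe (σ ⟨t, h, h'⟩)
    exact h1.trans h2.symm

theorem rev_trans (f : Curve c x y) : (f.rev.trans f).Homotopic (const c y) := by
  refine homotopic_of_comp f.extend_cont (φ := fun t => |2 * t - 1|) (ψ := fun _ => 1)
    (by fun_prop) (by fun_prop) (by norm_num) (by norm_num) ?_
    (fun t => (f.extend_of_one_le le_rfl).symm)
  intro t
  simp only [trans]
  split_ifs with h
  · rw [extend_rev, abs_of_nonpos (by linarith)]
    congr 1
    ring
  · rw [abs_of_nonneg (by linarith)]

theorem extend_trans (a : Curve c x y) (b : Curve c y z) (t : ℝ) : (a.trans b).extend t =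
    if t ≤ 1 / 2 then a.extend (2 * t) else b.extend (2 * t - 1) := by
  rcases le_total t 0 with h | h
  · rw [extend_of_le_zero _ h, if_pos (by linarith), extend_of_le_zero _ (by linarith)]
  rcases le_total 1 t with h' | h'
  · rw [extend_of_one_le _ h', if_neg (by linarith), extend_of_one_le _ (by linarith)]
  · exact (a.trans b).extend_coe ⟨t, h, h'⟩

theorem trans_assoc {w : X} (f : Curve c x y) (g : Curve c y z) (h : Curve c z w) :
    ((f.trans g).trans h).Homotopic (f.trans (g.trans h)) := by
  -- The three curves laid end to end on `[0,1]`, `[1,2]`, `[2,3]`; the two bracketings are two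
  -- piecewise linear parametrizations of this map, both with their corner at `1/2`.
  have hF : (ofTopology ℝ).IsContinuous c
      (fun t => if t ≤ 1 then f.extend t else (if t ≤ 2 then g.extend (t - 1)
        else h.extend (t - 2))) := by
    refine IsContinuous.ite_le (u := fun t : ℝ => t) (v := fun _ => 1) f.extend_cont
      (IsContinuous.ite_le (u := fun t : ℝ => t) (v := fun _ => 2)
        (g.extend_cont.comp_continuous (by fun_prop))
        (h.extend_cont.comp_continuous (by fun_prop)) (by fun_prop) (by fun_prop) ?_)
        (by fun_prop) (by fun_prop) ?_
    · intro t ht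
      rw [g.extend_of_one_le (by linarith), h.extend_of_le_zero (by linarith)]
    · intro t ht
      rw [f.extend_of_one_le (by linarith), if_pos (by linarith),
        g.extend_of_le_zero (by linarith)]
  refine homotopic_of_comp hF (φ := fun t => min (4 * t) (2 * t + 1))
    (ψ := fun t => max (2 * t) (4 * t - 1))
    (by fun_prop) (by fun_prop) (by norm_num) (by norm_num) ?_ ?_
  · intro t
    change (if (t : ℝ) ≤ 1 / 2 then (f.trans g).extend (2 * t) else h.extend (2 * t - 1)) = _
    rw [extend_trans]
    rcases le_or_gt (t : ℝ) (1 / 2) with h2 | h2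
    · rw [if_pos h2, min_eq_left (by linarith)]
      rcases le_or_gt (t : ℝ) (1 / 4) with h4 | h4
      · rw [if_pos (by linarith), if_pos (by linarith)]
        congr 1
        ring
      · rw [if_neg (by linarith), if_neg (by linarith), if_pos (by linarith)]
        congr 1
        ring
    · rw [if_neg h2.not_ge, min_eq_right (by linarith), if_neg (by linarith),
        if_neg (by linarith)]
      congr 1
      ring
  · intro t
    change (if (t : ℝ) ≤ 1 / 2 then f.extend (2 * t) else (g.trans h).extend (2 * t - 1)) = _
    rw [extend_trans]
    rcases le_or_gt (t : ℝ) (1 / 2) with h2 | h2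
    · rw [if_pos h2, max_eq_left (by linarith), if_pos (by linarith)]
    · rw [if_neg h2.not_ge, max_eq_right (by linarith)]
      rcases le_or_gt (t : ℝ) (3 / 4) with h4 | h4
      · rw [if_pos (by linarith), if_neg (by linarith), if_pos (by linarith)]
        congr 1
        ring
      · rw [if_neg (by linarith), if_neg (by linarith), if_neg (by linarith)]
        congr 1
        ring

instance setoid (c : CechClosure X) (x y : X) : Setoid (Curve c x y) where
  r := Homotopic
  iseqv := ⟨Homotopic.refl, Homotopic.symm, Homotopic.trans⟩

theorem rev_rev (f : Curve c x y) : f.rev.rev = f := by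
  cases f
  simp [rev]

theorem trans_rev (f : Curve c x y) : (f.trans f.rev).Homotopic (const c x) := by
  simpa only [rev_rev] using rev_trans f.rev

end Curve

/-- The points of a closure space, as the objects of its fundamental groupoid. -/
def Points (_ : CechClosure X) : Type _ := X

/-- A point, as an object of the fundamental groupoid. -/
def pt (c : CechClosure X) (x : X) : c.Points := x

/-- The fundamental groupoid of a closure space: homotopy classes of curves relative to the
endpoints. -/
noncomputable instance (c : CechClosure X) : Groupoid c.Points where
  Hom x y := Quotient (Curve.setoid c x y)
  id x := Quotient.mk _ (Curve.const c x)
  comp := Quotient.map₂ Curve.trans fun _ _ h _ _ h' => Curve.Homotopic.trans_congr h h'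
  inv := Quotient.map Curve.rev fun _ _ h => Curve.Homotopic.rev_congr h
  id_comp := by
    rintro _ _ ⟨f⟩
    exact Quotient.sound (Curve.const_trans f)
  comp_id := by
    rintro _ _ ⟨f⟩
    exact Quotient.sound (Curve.trans_const f)
  assoc := by
    rintro _ _ _ _ ⟨f⟩ ⟨g⟩ ⟨h⟩
    exact Quotient.sound (Curve.trans_assoc f g h)
  inv_comp := by
    rintro _ _ ⟨f⟩
    exact Quotient.sound (Curve.rev_trans f)
  comp_inv := by
    rintro _ _ ⟨f⟩
    exact Quotient.sound (Curve.trans_rev f)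

/-- The class of a curve in the fundamental groupoid. -/
def Curve.cls (f : Curve c x y) : c.pt x ⟶ c.pt y :=
  Quotient.mk _ f

namespace Curve

theorem cls_eq {f g : Curve c x y} : f.cls = g.cls ↔ f.Homotopic g :=
  Quotient.eq (r := setoid c x y)

theorem cls_surjective {x y : c.Points} (p : x ⟶ y) : ∃ f : Curve c x y, f.cls = p :=
  Quotient.exists_rep p

theorem cls_trans (f : Curve c x y) (g : Curve c y z) : (f.trans g).cls = f.cls ≫ g.cls := rfl

theorem cls_const (c : CechClosure X) (x : X) : (const c x).cls = 𝟙 (c.pt x) := rfl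

end Curve

/-- The fundamental group is the vertex group of the fundamental groupoid. -/
def FundamentalGroup.toHom {x : X} :
    c.FundamentalGroup x ≃ (c.pt x ⟶ c.pt x) where
  toFun := Quotient.map (fun f => ⟨f.1, f.2, f.3, f.4⟩) fun _ _ h => h
  invFun := Quotient.map (fun f => ⟨f.1, f.2, f.3, f.4⟩) fun _ _ h => h
  left_inv := by rintro ⟨f⟩; rfl
  right_inv := by rintro ⟨f⟩; rfl

theorem FundamentalGroup.toHom_mul {x : X} (p q : c.FundamentalGroup x) :
    toHom (p * q) = toHom p ≫ toHom q := by
  obtain ⟨f⟩ := p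
  obtain ⟨g⟩ := q
  rfl

end CechClosure

/-! ### Local cocycles, coverings and the degree of a curve -/

namespace CechClosure

open Filter

section Lift

variable {A B G : Type*} [TopologicalSpace A] [TopologicalSpace B] [Group G]

/-- A system of transition elements `h p q`, for `q` near `p`, with the cocycle condition. -/
def IsLocalCocycle (h : A → A → G) : Prop :=
  ∀ p, h p p = 1 ∧ ∀ᶠ q in 𝓝 p, ∀ᶠ q' in 𝓝 q, h p q * h q q' = h p q'

/-- A function whose increments are prescribed locally by `h`. -/
def IsLocalLift (h : A → A → G) (g : A → G) : Prop :=
  ∀ p, ∀ᶠ q in 𝓝 p, g q = g p * h p q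

theorem IsLocalLift.comp {h : B → B → G} {g : B → G} (hg : IsLocalLift h g) {f : A → B}
    (hf : Continuous f) : IsLocalLift (fun p q => h (f p) (f q)) (fun p => g (f p)) :=
  fun p => hf.continuousAt.eventually (hg (f p))

theorem IsLocalLift.const_mul {h : A → A → G} {g : A → G} (hg : IsLocalLift h g) (a : G) :
    IsLocalLift h fun p => a * g p := by
  intro p
  filter_upwards [hg p] with q hq
  rw [hq, mul_assoc]

theorem IsLocalLift.map {H : Type*} [Group H] {h : A → A → G} {g : A → G}
    (hg : IsLocalLift h g) (f : G →* H) :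
    IsLocalLift (fun p q => f (h p q)) fun p => f (g p) := by
  intro p
  filter_upwards [hg p] with q hq
  rw [hq, map_mul]

/-- Increments multiply on the right, so they cancel in `g * g'⁻¹`, which is therefore locally
constant: two lifts differ by a left translation. -/
theorem IsLocalLift.mul_inv_eq [PreconnectedSpace A] {h : A → A → G} {g g' : A → G}
    (hg : IsLocalLift h g) (hg' : IsLocalLift h g') (p q : A) :
    g p * (g' p)⁻¹ = g q * (g' q)⁻¹ := by
  have : IsLocallyConstant fun p => g p * (g' p)⁻¹ := by
    rw [IsLocallyConstant.iff_eventually_eq]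
    intro p
    filter_upwards [hg p, hg' p] with q hq hq'
    rw [hq, hq']
    group
  exact this.apply_eq_of_preconnectedSpace p q

theorem IsLocalLift.eq_of_eq [PreconnectedSpace A] {h : A → A → G} {g g' : A → G}
    (hg : IsLocalLift h g) (hg' : IsLocalLift h g') {p : A} (hp : g p = g' p) (q : A) :
    g q = g' q := by
  have := hg.mul_inv_eq hg' p q
  rw [hp, mul_inv_cancel] at this
  exact (mul_inv_eq_one.1 this.symm)

theorem IsLocalLift.eq_of_forall_eq_one [PreconnectedSpace A] {h : A → A → G} {g : A → G}
    (hg : IsLocalLift h g) (h1 : ∀ p q, h p q = 1) (p q : A) : g p = g q := by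
  refine (IsLocalLift.eq_of_eq hg (g' := fun _ => g p) ?_ (p := p) rfl q).symm
  intro a
  simp [h1]

/-- The covering with fiber `G` defined by a local cocycle. -/
noncomputable def IsLocalCocycle.core [TopologicalSpace G] [DiscreteTopology G] {h : A → A → G}
    (hh : IsLocalCocycle h) : FiberBundleCore A A G where
  baseSet p := interior {q | ∀ᶠ q' in 𝓝 q, h p q * h q q' = h p q'}
  isOpen_baseSet _ := isOpen_interior
  indexAt p := p
  mem_baseSet_at p := mem_interior_iff_mem_nhds.2 (hh p).2
  -- The coordinate `v` in the chart `p` stands for the value `v * h p x` at `x`, whatever the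
  -- chart. Near a point of two base sets the cocycle identity makes the coordinate change locally
  -- constant.
  coordChange p q x v := v * h p x * (h q x)⁻¹
  coordChange_self p x _ v := by group
  continuousOn_coordChange p q := by
    rintro ⟨x, v⟩ ⟨⟨hx, hx'⟩, -⟩
    refine ContinuousAt.continuousWithinAt ?_
    have h1 : ∀ᶠ z : A × G in 𝓝 (x, v), z.2 = v :=
      (continuousAt_snd (p := (x, v))).eventually (p := fun w => w = v) (by simp)
    have hx1 : ∀ᶠ q' in 𝓝 x, h p x * h x q' = h p q' :=
      interior_subset (s := {q | ∀ᶠ q' in 𝓝 q, h p q * h q q' = h p q'}) hx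
    have hx2 : ∀ᶠ q' in 𝓝 x, h q x * h x q' = h q q' :=
      interior_subset (s := {r | ∀ᶠ q' in 𝓝 r, h q r * h r q' = h q q'}) hx'
    have h2 := (continuousAt_fst (p := (x, v))).eventually
      (p := fun q' => h p x * h x q' = h p q') hx1
    have h3 := (continuousAt_fst (p := (x, v))).eventually
      (p := fun q' => h q x * h x q' = h q q') hx2
    refine (continuousAt_const (y := v * h p x * (h q x)⁻¹)).congr ?_
    filter_upwards [h1, h2, h3] with z hz1 hz2 hz3
    rw [hz1, ← hz2, ← hz3]
    group
  coordChange_comp p q r x _ v := by group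

/-- The identity of a simply connected space lifts to the covering `core`. Seen in the chart at `q`,
this section is `g q' * (h q q')⁻¹`, continuous into a discrete group and so constant near `q`; that
constancy is the lift equation. -/
theorem IsLocalCocycle.exists_isLocalLift [SimplyConnectedSpace A] [LocallyPathConnectedSpace A]
    {h : A → A → G} (hh : IsLocalCocycle h) (p : A) (a : G) :
    ∃ g : A → G, IsLocalLift h g ∧ g p = a := by
  let _ : TopologicalSpace G := ⊥
  have : DiscreteTopology G := ⟨rfl⟩
  have cov : IsCoveringMap hh.core.proj :=
    FiberBundle.isCoveringMap (F := G) (E := hh.core.Fiber)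
  obtain ⟨F, ⟨hF0, hF⟩, -⟩ := cov.existsUnique_continuousMap_lifts (ContinuousMap.id A) p
    (⟨p, a⟩ : hh.core.TotalSpace) rfl
  have hF1 : ∀ q, (F q).1 = q := fun q => congrFun hF q
  let g : A → G := fun q => (F q).2
  have hg : g p = a := by
    change (show G from (F p).2) = a
    rw [hF0]
  refine ⟨g, fun q => ?_, hg⟩
  have hq : F q ∈ (hh.core.localTriv q).source := by
    rw [FiberBundleCore.mem_localTriv_source, hF1]
    exact hh.core.mem_baseSet_at q
  have hc : ContinuousAt (fun q' => (hh.core.localTriv q (F q')).2) q :=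
    continuousAt_snd.comp
      (((hh.core.localTriv q).continuousAt hq).comp F.continuous.continuousAt)
  have hv : ∀ q', (hh.core.localTriv q (F q')).2 = g q' * (h q q')⁻¹ := by
    intro q'
    change g q' * h (F q').1 (F q').1 * (h q (F q').1)⁻¹ = _
    rw [hF1, (hh q').1, mul_one]
  have he : ∀ᶠ q' in 𝓝 q,
      (hh.core.localTriv q (F q')).2 = (hh.core.localTriv q (F q)).2 :=
    hc.eventually (p := fun w => w = (hh.core.localTriv q (F q)).2) (by simp)
  filter_upwards [he] with q' hq'
  rw [hv, hv, (hh q).1, inv_one, mul_one] at hq'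
  rw [← hq', inv_mul_cancel_right]

end Lift

variable {X G : Type*} [Group G] {c : CechClosure X} {N : X → Set X} {φ : X → X → G}

/-- A system of transition elements on a closure space, satisfying the cocycle condition on the
neighborhoods `N x`. -/
structure IsCocycle (c : CechClosure X) (N : X → Set X) (φ : X → X → G) : Prop where
  isNhd : ∀ x, c.IsNhd (N x) x
  mul : ∀ x, ∀ y ∈ N x, ∀ z ∈ N x, z ∈ N y → φ x y * φ y z = φ x z

theorem IsCocycle.self (hφ : IsCocycle c N φ) (x : X) : φ x x = 1 := by
  have h := (hφ.isNhd x).mem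
  exact mul_eq_left.1 (hφ.mul x x h x h h)

theorem IsCocycle.isLocalCocycle (hφ : IsCocycle c N φ) {A : Type*} [TopologicalSpace A]
    {f : A → X} (hf : (ofTopology A).IsContinuous c f) :
    IsLocalCocycle fun p q => φ (f p) (f q) := by
  rw [isContinuous_ofTopology_iff] at hf
  intro p
  refine ⟨hφ.self _, ?_⟩
  filter_upwards [eventually_eventually_nhds.2 (hf p _ (hφ.isNhd (f p)))] with q hq
  filter_upwards [hq, hf q _ (hφ.isNhd (f q))] with q' h1 h2
  exact hφ.mul _ _ hq.self_of_nhds _ h1 h2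

namespace Curve

theorem exists_lift (hφ : IsCocycle c N φ) {x y : X} (f : Curve c x y) :
    ∃ g : ℝ → G, IsLocalLift (fun p q => φ (f.extend p) (f.extend q)) g ∧ g 0 = 1 :=
  (hφ.isLocalCocycle f.extend_cont).exists_isLocalLift 0 1

/-- The total increment of a lift along a curve. -/
noncomputable def degree (hφ : IsCocycle c N φ) {x y : X} (f : Curve c x y) : G :=
  (f.exists_lift hφ).choose 1

/-- Lifts differ by left translation, so the total increment may be read off any lift, with any
initial value. -/
theorem degree_eq (hφ : IsCocycle c N φ) {x y : X} (f : Curve c x y) {g : ℝ → G}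
    (hg : IsLocalLift (fun p q => φ (f.extend p) (f.extend q)) g) :
    f.degree hφ = (g 0)⁻¹ * g 1 := by
  obtain ⟨h1, h2⟩ := (f.exists_lift hφ).choose_spec
  exact h1.eq_of_eq (hg.const_mul (g 0)⁻¹) (p := 0) (by rw [h2, inv_mul_cancel]) 1

theorem degree_trans (hφ : IsCocycle c N φ) {x y z : X} (f : Curve c x y) (f' : Curve c y z) :
    (f.trans f').degree hφ = f.degree hφ * f'.degree hφ := by
  obtain ⟨g, hg, -⟩ := (f.trans f').exists_lift hφ
  -- Restrict one lift of the concatenation to its two halves. The clamps hold the parameter at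
  -- `1/2`, where it would otherwise run into the other curve.
  have h1 : IsLocalLift (fun p q => φ (f.extend p) (f.extend q)) fun t => g (min t 1 / 2) := by
    have := hg.comp (f := fun t : ℝ => min t 1 / 2) (by fun_prop)
    have e : ∀ t, (f.trans f').extend (min t 1 / 2) = f.extend t := by
      intro t
      rw [extend_trans, if_pos (by have := min_le_right t 1; linarith)]
      rcases le_total t 1 with h | h
      · rw [min_eq_left h]
        congr 1
        ring
      · rw [min_eq_right h, f.extend_of_one_le h, f.extend_of_one_le (by norm_num)]
    simpa only [e] using this
  have h2 : IsLocalLift (fun p q => φ (f'.extend p) (f'.extend q))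
      fun t => g ((max t 0 + 1) / 2) := by
    have := hg.comp (f := fun t : ℝ => (max t 0 + 1) / 2) (by fun_prop)
    have e : ∀ t, (f.trans f').extend ((max t 0 + 1) / 2) = f'.extend t := by
      intro t
      rw [extend_trans]
      rcases le_or_gt t 0 with h | h
      · rw [max_eq_right h, if_pos (by norm_num), f.extend_of_one_le (by norm_num),
          f'.extend_of_le_zero h]
      · rw [max_eq_left h.le, if_neg (by linarith)]
        congr 1
        ring
    simpa only [e] using this
  rw [degree_eq hφ _ hg, degree_eq hφ _ h1, degree_eq hφ _ h2]
  norm_num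

/-- Lift the homotopy, extended to the plane. The vertical sides map to single points, so the lift
is constant on them and the two horizontal sides have the same increment. -/
theorem Homotopic.degree_eq (hφ : IsCocycle c N φ) {x y : X} {f f' : Curve c x y}
    (h : f.Homotopic f') : f.degree hφ = f'.degree hφ := by
  obtain ⟨H, hH, h0, h1, ha, hb⟩ := h
  rw [isContinuous_prod_iff] at hH
  have hF := hH.comp_continuous (A := ℝ × ℝ)
    (g := fun p => (projIcc 0 1 zero_le_one p.1, projIcc 0 1 zero_le_one p.2))
    ((continuous_projIcc.comp continuous_fst).prodMk (continuous_projIcc.comp continuous_snd))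
  obtain ⟨g, hg, -⟩ := (hφ.isLocalCocycle hF).exists_isLocalLift 0 1
  have e0 : IsLocalLift (fun p q => φ (f.extend p) (f.extend q)) fun s => g (s, 0) := by
    have := hg.comp (f := fun s : ℝ => (s, (0 : ℝ))) (by fun_prop)
    simp only [projIcc_left, Icc.mk_zero, h0] at this
    exact this
  have e1 : IsLocalLift (fun p q => φ (f'.extend p) (f'.extend q)) fun s => g (s, 1) := by
    have := hg.comp (f := fun s : ℝ => (s, (1 : ℝ))) (by fun_prop)
    simp only [projIcc_right, Icc.mk_one, h1] at this
    exact this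
  have ea : g (0, 0) = g (0, 1) := by
    have := hg.comp (f := fun s : ℝ => ((0 : ℝ), s)) (by fun_prop)
    refine this.eq_of_forall_eq_one (fun p q => ?_) 0 1
    simp only [projIcc_left, Icc.mk_zero, ha, hφ.self]
  have eb : g (1, 0) = g (1, 1) := by
    have := hg.comp (f := fun s : ℝ => ((1 : ℝ), s)) (by fun_prop)
    refine this.eq_of_forall_eq_one (fun p q => ?_) 0 1
    simp only [projIcc_right, Icc.mk_one, hb, hφ.self]
  rw [Curve.degree_eq hφ f e0, Curve.degree_eq hφ f' e1, ea, eb]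

end Curve

open CategoryTheory

/-- The degree of a morphism of the fundamental groupoid. -/
noncomputable def IsCocycle.deg (hφ : IsCocycle c N φ) {x y : c.Points} (p : x ⟶ y) : G :=
  Quotient.lift (s := Curve.setoid c x y) (fun f => f.degree hφ)
    (fun _ _ h => Curve.Homotopic.degree_eq hφ h) p

theorem IsCocycle.deg_cls (hφ : IsCocycle c N φ) {x y : X} (f : Curve c x y) :
    hφ.deg f.cls = f.degree hφ := rfl

theorem IsCocycle.deg_comp (hφ : IsCocycle c N φ) {x y z : c.Points} (p : x ⟶ y) (q : y ⟶ z) :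
    hφ.deg (p ≫ q) = hφ.deg p * hφ.deg q := by
  obtain ⟨f, rfl⟩ := Curve.cls_surjective p
  obtain ⟨g, rfl⟩ := Curve.cls_surjective q
  exact Curve.degree_trans hφ f g

end CechClosure

/-! ### From a cocycle to the fundamental group -/

namespace CechClosure

open CategoryTheory

variable {X G : Type*} [Group G] {c : CechClosure X} {N : X → Set X} {φ : X → X → G}

namespace Curve

/-- The image of the affine path from `s` to `t` under a continuous map on the real line. -/
def ofReal {F : ℝ → X} (hF : (ofTopology ℝ).IsContinuous c F) {x y : X} (s t : ℝ)
    (hs : F s = x) (ht : F t = y) : Curve c x y where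
  toFun τ := F (s + τ * (t - s))
  cont := hF.comp_continuous (by fun_prop)
  source := by simpa using hs
  target := by simpa using ht

theorem extend_ofReal {F : ℝ → X} (hF : (ofTopology ℝ).IsContinuous c F) {x y : X} (s t : ℝ)
    (hs : F s = x) (ht : F t = y) {τ : ℝ} (h0 : 0 ≤ τ) (h1 : τ ≤ 1) :
    (ofReal hF s t hs ht).extend τ = F (s + τ * (t - s)) :=
  (ofReal hF s t hs ht).extend_coe ⟨τ, h0, h1⟩

theorem cls_ofReal_comp {F : ℝ → X} (hF : (ofTopology ℝ).IsContinuous c F) {x y z : X}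
    (s t u : ℝ) (hs : F s = x) (ht : F t = y) (hu : F u = z) :
    (ofReal hF s t hs ht).cls ≫ (ofReal hF t u ht hu).cls = (ofReal hF s u hs hu).cls := by
  rw [← cls_trans, cls_eq]
  refine homotopic_of_comp hF
    (φ := fun τ : I => s + min (2 * (τ : ℝ)) 1 * (t - s) + max (2 * (τ : ℝ) - 1) 0 * (u - t))
    (ψ := fun τ : I => s + τ * (u - s)) (by fun_prop) (by fun_prop) (by norm_num) (by norm_num)
    ?_ (fun _ => rfl)
  intro τ
  have := τ.2.1
  have := τ.2.2
  simp only [trans]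
  split_ifs with h
  · rw [extend_ofReal _ _ _ _ _ (by linarith) (by linarith), min_eq_left (by linarith),
      max_eq_right (by linarith)]
    congr 1
    ring
  · rw [extend_ofReal _ _ _ _ _ (by linarith) (by linarith), min_eq_right (by linarith),
      max_eq_left (by linarith)]
    congr 1
    ring

theorem cls_ofReal_self {F : ℝ → X} (hF : (ofTopology ℝ).IsContinuous c F) {x : X} (s : ℝ)
    (hs : F s = x) : (ofReal hF s s hs hs).cls = 𝟙 (c.pt x) := by
  have : ofReal hF s s hs hs = const c x := by simp [ofReal, const, hs]
  rw [this, cls_const]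

theorem inv_cls_ofReal {F : ℝ → X} (hF : (ofTopology ℝ).IsContinuous c F) {x y : X} (s t : ℝ)
    (hs : F s = x) (ht : F t = y) :
    CategoryTheory.inv (ofReal hF s t hs ht).cls = (ofReal hF t s ht hs).cls := by
  rw [IsIso.inv_eq_of_hom_inv_id]
  rw [cls_ofReal_comp, cls_ofReal_self]

theorem ofReal_extend {x y : X} (f : Curve c x y) :
    ofReal f.extend_cont 0 1 (f.extend_of_le_zero le_rfl) (f.extend_of_one_le le_rfl) = f := by
  cases f
  simp [ofReal, extend]

end Curve

/-- Close up each initial segment of `f` with the connecting classes `γ`. By `hloc` the resulting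
loop classes have the increments `ψ (φ _ _)`, as does the image under `ψ` of a lift of `f`; both
start at 1, so they agree at the end. Uniqueness of lifts thus replaces a subdivision of the
interval. -/
theorem IsCocycle.conj_eq (hφ : IsCocycle c N φ) {o : X}
    (γ : ∀ x : X, c.pt o ⟶ c.pt x)
    (ψ : G →* c.FundamentalGroup o)
    (hloc : ∀ (x y : X) (u : Curve c x y), (∀ t, u.toFun t ∈ N x) →
      γ x ≫ u.cls ≫ inv (γ y) = FundamentalGroup.toHom (ψ (φ x y)))
    {x y : X} (f : Curve c x y) :
    γ x ≫ f.cls ≫ inv (γ y) = FundamentalGroup.toHom (ψ (f.degree hφ)) := by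
  have h0 := f.extend_of_le_zero le_rfl
  obtain ⟨g, hg, hg0⟩ := f.exists_lift hφ
  let k : ℝ → c.FundamentalGroup o := fun s => FundamentalGroup.toHom.symm
    (γ x ≫ (Curve.ofReal f.extend_cont 0 s h0 rfl).cls ≫ inv (γ (f.extend s)))
  have hk (s : ℝ) (z : X) (hz : f.extend s = z) : FundamentalGroup.toHom (k s) =
      γ x ≫ (Curve.ofReal f.extend_cont 0 s h0 hz).cls ≫ inv (γ z) := by
    subst hz
    exact Equiv.apply_symm_apply _ _
  have hlift : IsLocalLift (fun p q => ψ (φ (f.extend p) (f.extend q))) k := by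
    intro s
    have hN := (isContinuous_ofTopology_iff.1 f.extend_cont) s _ (hφ.isNhd (f.extend s))
    obtain ⟨ε, hε, hball⟩ := Metric.mem_nhds_iff.1 hN
    filter_upwards [Metric.ball_mem_nhds s hε] with t ht
    apply FundamentalGroup.toHom.injective
    rw [FundamentalGroup.toHom_mul,
      ← hloc _ _ (Curve.ofReal f.extend_cont s t rfl rfl), hk s _ rfl, hk t _ rfl,
      ← Curve.cls_ofReal_comp f.extend_cont 0 s t h0 rfl rfl]
    · simp
    · intro τ
      -- The affine path from `s` to `t` stays as close to `s` as `t` is, so its image lies in the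
      -- prescribed neighborhood.
      apply hball
      rw [Metric.mem_ball, Real.dist_eq] at ht ⊢
      refine lt_of_le_of_lt ?_ ht
      rw [add_sub_cancel_left, abs_mul, abs_of_nonneg τ.2.1]
      exact mul_le_of_le_one_left (abs_nonneg _) τ.2.2
  have hk0 : k 0 = ψ (g 0) := by
    apply FundamentalGroup.toHom.injective
    rw [hg0, map_one, hk 0 x h0, Curve.cls_ofReal_self]
    simp
    rfl
  have h1 := f.extend_of_one_le le_rfl
  have hk1 := hk 1 y h1
  rw [Curve.ofReal_extend] at hk1
  rw [← hk1, hlift.eq_of_eq (hg.map ψ) hk0 1, f.degree_eq hφ hg, hg0, inv_one, one_mul]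

/-- A closure space whose fundamental groupoid is locally determined by a cocycle with values in
`G`, all of whose values are realized by loops, has fundamental group `G`. -/
theorem IsCocycle.nonempty_mulEquiv (hφ : IsCocycle c N φ) {o : X}
    (γ : ∀ x : X, c.pt o ⟶ c.pt x)
    (ψ : G →* c.FundamentalGroup o)
    (hloc : ∀ (x y : X) (u : Curve c x y), (∀ t, u.toFun t ∈ N x) →
      γ x ≫ u.cls ≫ inv (γ y) = FundamentalGroup.toHom (ψ (φ x y)))
    (hdeg : ∀ g, hφ.deg (FundamentalGroup.toHom (ψ g)) = g) (x : X) :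
    Nonempty (c.FundamentalGroup x ≃* G) := by
  have hconj (p : c.pt x ⟶ c.pt x) :
      γ x ≫ p ≫ inv (γ x) = FundamentalGroup.toHom (ψ (hφ.deg p)) := by
    obtain ⟨f, rfl⟩ := Curve.cls_surjective p
    exact hφ.conj_eq γ ψ hloc f
  let D : c.FundamentalGroup x →* G := MonoidHom.mk' (fun p => hφ.deg (FundamentalGroup.toHom p))
    fun p q => by rw [FundamentalGroup.toHom_mul, hφ.deg_comp]
  refine ⟨MulEquiv.ofBijective D ⟨fun p q h => ?_, fun g => ?_⟩⟩
  · apply FundamentalGroup.toHom.injective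
    have h' : γ x ≫ FundamentalGroup.toHom p ≫ inv (γ x) =
        γ x ≫ FundamentalGroup.toHom q ≫ inv (γ x) := by
      rw [hconj, hconj]
      exact congrArg _ (congrArg _ h)
    exact (cancel_mono (inv (γ x))).1 ((cancel_epi (γ x)).1 h')
  · have hid : hφ.deg (inv (γ x)) * hφ.deg (γ x) = 1 := by
      rw [← hφ.deg_comp, IsIso.inv_hom_id, ← Curve.cls_const, hφ.deg_cls,
        Curve.degree_eq hφ _ (g := fun _ => 1)]
      · simp
      · intro p
        refine Filter.Eventually.of_forall fun q => ?_
        change 1 = 1 * φ _ _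
        rw [one_mul]
        exact (hφ.self x).symm
    -- Moving a loop from `o` to `x` conjugates its degree by that of `γ x`; the element given to
    -- `ψ` is conjugated in advance to undo this.
    refine ⟨FundamentalGroup.toHom.symm (inv (γ x) ≫ FundamentalGroup.toHom
      (ψ (hφ.deg (γ x) * g * hφ.deg (inv (γ x)))) ≫ γ x), ?_⟩
    change hφ.deg (FundamentalGroup.toHom (FundamentalGroup.toHom.symm _)) = g
    rw [Equiv.apply_symm_apply, hφ.deg_comp, hφ.deg_comp, hdeg]
    calc _ = (hφ.deg (inv (γ x)) * hφ.deg (γ x)) * g * (hφ.deg (inv (γ x)) * hφ.deg (γ x)) := by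
          group
      _ = g := by rw [hid, one_mul, mul_one]

end CechClosure

/-! ### Short representatives and winding numbers on the circle -/

namespace UnitAddCircle

theorem exists_eq_add_intCast {s t : ℝ} (h : (s : UnitAddCircle) = t) : ∃ n : ℤ, s = t + n := by
  have h' : ((s - t : ℝ) : UnitAddCircle) = 0 := by
    rw [AddCircle.coe_sub, h, sub_self]
  obtain ⟨n, hn⟩ := (AddCircle.coe_eq_zero_iff (1 : ℝ)).1 h'
  refine ⟨n, ?_⟩
  rw [zsmul_one] at hn
  linarith

theorem norm_coe_le (t : ℝ) : ‖(t : UnitAddCircle)‖ ≤ |t| := by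
  rw [UnitAddCircle.norm_eq]
  simpa using round_le t 0

theorem dist_coe_le (s t : ℝ) : dist (s : UnitAddCircle) t ≤ |s - t| := by
  rw [dist_eq_norm, ← AddCircle.coe_sub]
  exact norm_coe_le _

theorem dist_le_half (a b : UnitAddCircle) : dist a b ≤ 1 / 2 := by
  rw [dist_eq_norm]
  simpa using AddCircle.norm_le_half_period (1 : ℝ) (x := a - b) one_ne_zero

/-- A representative of smallest absolute value. -/
noncomputable def rep (a : UnitAddCircle) : ℝ :=
  (QuotientAddGroup.mk_surjective a).choose - round (QuotientAddGroup.mk_surjective a).choose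

@[simp]
theorem coe_rep (a : UnitAddCircle) : (rep a : UnitAddCircle) = a := by
  have h : ((QuotientAddGroup.mk_surjective a).choose : UnitAddCircle) = a :=
    (QuotientAddGroup.mk_surjective a).choose_spec
  rw [rep, AddCircle.coe_sub, h, sub_eq_self, AddCircle.coe_eq_zero_iff]
  exact ⟨_, zsmul_one _⟩

theorem abs_rep (a : UnitAddCircle) : |rep a| = ‖a‖ := by
  have h : ((QuotientAddGroup.mk_surjective a).choose : UnitAddCircle) = a :=
    (QuotientAddGroup.mk_surjective a).choose_spec
  rw [rep, ← UnitAddCircle.norm_eq, h]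

@[simp]
theorem rep_zero : rep 0 = 0 := by
  rw [← abs_eq_zero, abs_rep, norm_zero]

theorem eq_of_coe_eq {s t : ℝ} (h : (s : UnitAddCircle) = t) (hst : |s - t| < 1) : s = t := by
  obtain ⟨n, hn⟩ := exists_eq_add_intCast h
  have : |(n : ℝ)| < 1 := by rwa [hn, add_sub_cancel_left] at hst
  have hn0 : n = 0 := Int.abs_lt_one_iff.1 (by exact_mod_cast this)
  rw [hn, hn0, Int.cast_zero, add_zero]

/-- Both sides represent the same point, so they differ by an integer, of absolute value less than 1
by hypothesis. The bound 1/3 comes from here, as a third of the circumference. -/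
theorem rep_add {a b : UnitAddCircle} (h : ‖a‖ + ‖b‖ + ‖a + b‖ < 1) :
    rep (a + b) = rep a + rep b := by
  refine eq_of_coe_eq (by simp) (lt_of_le_of_lt ?_ h)
  calc |rep (a + b) - (rep a + rep b)| ≤ |rep (a + b)| + (|rep a| + |rep b|) :=
        (abs_sub _ _).trans (add_le_add_right (abs_add_le _ _) _)
    _ = _ := by rw [abs_rep, abs_rep, abs_rep]; ring

theorem rep_coe {t : ℝ} (ht : |t| < 1 / 2) : rep t = t := by
  refine eq_of_coe_eq (by simp) (lt_of_le_of_lt (abs_sub _ _) ?_)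
  rw [abs_rep]
  linarith [norm_coe_le t]

/-- The winding number of the loop that follows the chosen representatives of the arcs from `0` to
`a`, from `a` to `b` and from `b` to `0`. -/
noncomputable def wind (a b : UnitAddCircle) : ℤ := round (rep a + rep (b - a) - rep b)

theorem coe_wind (a b : UnitAddCircle) : (wind a b : ℝ) = rep a + rep (b - a) - rep b := by
  obtain ⟨n, hn⟩ := exists_eq_add_intCast (s := rep a + rep (b - a)) (t := rep b) (by simp)
  rw [wind, hn, add_sub_cancel_left, round_intCast]

@[simp]
theorem wind_self (a : UnitAddCircle) : wind a a = 0 := by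
  simp [wind]

/-- The sides of the triangle have total length less than 1, so their representatives add by
`rep_add`; the terms joining the vertices to `0` telescope. -/
theorem wind_add_wind {a b c : UnitAddCircle} (hab : dist a b < 1 / 3) (hbc : dist b c < 1 / 3)
    (hac : dist a c < 1 / 3) : wind a b + wind b c = wind a c := by
  have h : rep (b - a + (c - b)) = rep (b - a) + rep (c - b) := by
    apply rep_add
    rw [dist_comm, dist_eq_norm] at hab hbc hac
    rw [show b - a + (c - b) = c - a by abel]
    linarith
  rw [show b - a + (c - b) = c - a by abel] at h
  have : (wind a b : ℝ) + wind b c = wind a c := by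
    rw [coe_wind, coe_wind, coe_wind, h]
    ring
  exact_mod_cast this

end UnitAddCircle

/-! ### Neighborhoods and continuity in the wedge -/

namespace WedgeOfCircles

/-- The inclusions of the two circles. -/
def incl (i : Fin 2) (a : UnitAddCircle) : WedgeOfCircles :=
  if i = 0 then Wedge.inl a else Wedge.inr a

/-- The projections to the two circles. -/
def proj (i : Fin 2) : WedgeOfCircles → UnitAddCircle :=
  Quot.lift (Sum.elim (fun a => if i = 0 then a else 0) fun a => if i = 0 then 0 else a)
    (by rintro _ _ ⟨⟩; simp)

@[simp]
theorem proj_incl_self (i : Fin 2) (a : UnitAddCircle) : proj i (incl i a) = a := by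
  fin_cases i <;> rfl

theorem proj_incl_of_ne {i j : Fin 2} (h : i ≠ j) (a : UnitAddCircle) :
    proj j (incl i a) = 0 := by
  fin_cases i <;> fin_cases j <;> first | rfl | exact absurd rfl h

theorem incl_zero (i j : Fin 2) : incl i 0 = incl j 0 := by
  have : (Wedge.inl 0 : WedgeOfCircles) = Wedge.inr 0 := Quot.sound .glue
  fin_cases i <;> fin_cases j <;> first | rfl | exact this | exact this.symm

theorem exists_incl (x : WedgeOfCircles) : ∃ i a, incl i a = x := by
  obtain ⟨a | a⟩ := x
  · exact ⟨0, a, rfl⟩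
  · exact ⟨1, a, rfl⟩

theorem incl_injective (i : Fin 2) : Function.Injective (incl i) :=
  Function.LeftInverse.injective (proj_incl_self i)

theorem incl_eq_incl {i j : Fin 2} (hij : i ≠ j) {a b : UnitAddCircle} (h : incl i a = incl j b) :
    a = 0 ∧ b = 0 := by
  constructor
  · rw [← proj_incl_self i a, h, proj_incl_of_ne hij.symm]
  · rw [← proj_incl_self j b, ← h, proj_incl_of_ne hij]

/-- The points that lie on a common circle with `x`, at distance less than the radius for that
circle. -/
def ball (ρ : Fin 2 → ℝ) (x : WedgeOfCircles) : Set WedgeOfCircles :=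
  {y | ∃ i a b, incl i a = x ∧ incl i b = y ∧ dist a b < ρ i}

theorem incl_mem_ball {ρ : Fin 2 → ℝ} {i : Fin 2} {a b : UnitAddCircle} (h : dist a b < ρ i) :
    incl i b ∈ ball ρ (incl i a) := ⟨i, a, b, rfl, rfl, h⟩

theorem incl_mem_ball_iff {ρ : Fin 2 → ℝ} (hρ : ∀ i, 0 < ρ i) {i : Fin 2}
    {a b : UnitAddCircle} : incl i b ∈ ball ρ (incl i a) ↔ dist a b < ρ i := by
  refine ⟨?_, incl_mem_ball⟩
  rintro ⟨j, a', b', ha, hb, h⟩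
  by_cases hij : j = i
  · subst hij
    rwa [← incl_injective j ha, ← incl_injective j hb]
  · rw [(incl_eq_incl hij ha).2, (incl_eq_incl hij hb).2, dist_self]
    exact hρ i

/-- Three points, each two of which lie on a common circle in the prescribed order of
neighborhoods, lie on one circle. -/
theorem exists_common {ρ ρ' ρ'' : Fin 2 → ℝ} {x y z : WedgeOfCircles} (hxy : y ∈ ball ρ x)
    (hxz : z ∈ ball ρ' x) (hyz : z ∈ ball ρ'' y) :
    ∃ i a b c, incl i a = x ∧ incl i b = y ∧ incl i c = z := by
  obtain ⟨i, a, b, rfl, rfl, -⟩ := hxy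
  obtain ⟨j, a', c, ha, rfl, -⟩ := hxz
  obtain ⟨k, b', c', hb, hc, -⟩ := hyz
  by_cases hij : j = i
  · subst hij
    exact ⟨j, a, b, c, rfl, rfl, rfl⟩
  -- Here `x` is the wedge point. The circle shared by `y` and `z` decides: either it is circle `i`,
  -- which then contains all three, or `y` is the wedge point too and circle `j` does.
  · obtain ⟨rfl, rfl⟩ := incl_eq_incl hij ha
    by_cases hik : k = i
    · subst hik
      exact ⟨k, 0, b, c', rfl, rfl, hc⟩
    · obtain ⟨rfl, rfl⟩ := incl_eq_incl hik hb
      exact ⟨j, 0, 0, c, incl_zero _ _, incl_zero _ _, rfl⟩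

variable {r : Fin 2 → ℝ≥0}

theorem mem_cl_iff {U : Set WedgeOfCircles} {x : WedgeOfCircles} :
    x ∈ (wedgeOfCirclesClosure (r 0) (r 1)).cl U ↔
      ∃ i a, incl i a = x ∧ Metric.infEDist a (incl i ⁻¹' U) ≤ r i := by
  constructor
  · rintro (⟨a, ha, rfl⟩ | ⟨a, ha, rfl⟩)
    · exact ⟨0, a, rfl, ha⟩
    · exact ⟨1, a, rfl, ha⟩
  · rintro ⟨i, a, rfl, ha⟩
    fin_cases i
    · exact Or.inl ⟨a, ha, rfl⟩
    · exact Or.inr ⟨a, ha, rfl⟩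

theorem isNhd_ball {ρ : Fin 2 → ℝ} (hρ : ∀ i, r i < ρ i) (x : WedgeOfCircles) :
    (wedgeOfCirclesClosure (r 0) (r 1)).IsNhd (ball ρ x) x := by
  intro hx
  obtain ⟨i, a, rfl, ha⟩ := mem_cl_iff.1 hx
  have : ENNReal.ofReal (ρ i) ≤ Metric.infEDist a (incl i ⁻¹' (ball ρ (incl i a))ᶜ) := by
    rw [Metric.le_infEDist]
    intro b hb
    rw [edist_dist]
    refine ENNReal.ofReal_le_ofReal (not_lt.1 fun h => hb (incl_mem_ball h))
  have h := this.trans ha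
  rw [← ENNReal.ofReal_coe_nnreal] at h
  exact absurd (hρ i) (not_lt.2 ((ENNReal.ofReal_le_ofReal_iff (r i).2).1 h))

/-- Lying outside the closure of the complement is a strict inequality between `r i` and a distance,
which leaves room for a radius in between. With `isNhd_ball`, the balls of radii above `r` form a
local base. -/
theorem exists_ball_subset {U : Set WedgeOfCircles} {x : WedgeOfCircles}
    (hU : (wedgeOfCirclesClosure (r 0) (r 1)).IsNhd U x) :
    ∃ ρ : Fin 2 → ℝ, (∀ i, r i < ρ i) ∧ ball ρ x ⊆ U := by
  have key : ∀ i, ∃ ρ : ℝ, r i < ρ ∧ ∀ a b, incl i a = x → dist a b < ρ → incl i b ∈ U := by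
    intro i
    by_cases hx : ∃ a, incl i a = x
    · obtain ⟨a, rfl⟩ := hx
      have h : (r i : ENNReal) < Metric.infEDist a (incl i ⁻¹' Uᶜ) :=
        not_le.1 fun h => hU (mem_cl_iff.2 ⟨i, a, rfl, h⟩)
      obtain ⟨ρ, h1, h2⟩ := ENNReal.lt_iff_exists_nnreal_btwn.1 h
      refine ⟨ρ, by exact_mod_cast h1, ?_⟩
      intro a' b ha hb
      rw [incl_injective i ha] at hb
      by_contra hbU
      have h3 : Metric.infEDist a (incl i ⁻¹' Uᶜ) ≤ edist a b := Metric.infEDist_le_edist_of_mem hbU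
      have h4 : edist a b ≤ ρ := by
        rw [edist_dist]
        exact ENNReal.ofReal_le_of_le_toReal (by simpa using hb.le)
      exact absurd (h2.trans_le h3) (not_lt.2 h4)
    · exact ⟨r i + 1, by linarith, fun a b ha => absurd ⟨a, ha⟩ hx⟩
  choose ρ h1 h2 using key
  refine ⟨ρ, h1, ?_⟩
  rintro _ ⟨i, a, b, ha, rfl, h⟩
  exact h2 i a b ha h

open CechClosure

theorem isContinuous_iff {A : Type*} [TopologicalSpace A] {f : A → WedgeOfCircles} :
    (ofTopology A).IsContinuous (wedgeOfCirclesClosure (r 0) (r 1)) f ↔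
      ∀ p, ∀ ρ : Fin 2 → ℝ, (∀ i, r i < ρ i) → ∀ᶠ q in 𝓝 p, f q ∈ ball ρ (f p) := by
  rw [isContinuous_ofTopology_iff]
  constructor
  · exact fun h p ρ hρ => h p _ (isNhd_ball hρ _)
  · intro h p U hU
    obtain ⟨ρ, hρ, hU⟩ := exists_ball_subset hU
    filter_upwards [h p ρ hρ] with q hq
    exact hU hq

end WedgeOfCircles

/-! ### The winding cocycle and the standard loops -/

namespace WedgeOfCircles

open CechClosure UnitAddCircle CategoryTheory

variable {r : Fin 2 → ℝ≥0} {ρ : Fin 2 → ℝ} {G : Type*} [Group G] {a : Fin 2 → G}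

/-- The transition elements given by the winding numbers on the two circles. -/
noncomputable def transition (a : Fin 2 → G) (x y : WedgeOfCircles) : G :=
  a 0 ^ wind (proj 0 x) (proj 0 y) * a 1 ^ wind (proj 1 x) (proj 1 y)

theorem transition_incl (i : Fin 2) (b c : UnitAddCircle) :
    transition a (incl i b) (incl i c) = a i ^ wind b c := by
  unfold transition
  fin_cases i
  · simp [proj_incl_of_ne]
  · simp [proj_incl_of_ne]

theorem isCocycle_transition (hρ : ∀ i, r i < ρ i) (ha : ∀ i, ρ i ≤ 1 / 3 ∨ a i = 1) :
    IsCocycle (wedgeOfCirclesClosure (r 0) (r 1)) (ball ρ) (transition a) := by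
  have hpos : ∀ i, 0 < ρ i := fun i => (r i).2.trans_lt (hρ i)
  refine ⟨isNhd_ball hρ, ?_⟩
  intro x y hy z hz hyz
  obtain ⟨i, b, c, d, rfl, rfl, rfl⟩ := exists_common hy hz hyz
  rw [incl_mem_ball_iff hpos] at hy hz hyz
  simp only [transition_incl]
  rcases ha i with h | h
  · rw [← zpow_add, wind_add_wind (by linarith) (by linarith) (by linarith)]
  · simp [h]

theorem isContinuous_incl_coe (i : Fin 2) : (ofTopology ℝ).IsContinuous
    (wedgeOfCirclesClosure (r 0) (r 1)) fun t => incl i t := by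
  rw [isContinuous_iff]
  intro p ρ hρ
  filter_upwards [Metric.ball_mem_nhds p ((r i).2.trans_lt (hρ i))] with q hq
  rw [Metric.mem_ball'] at hq
  exact incl_mem_ball ((dist_coe_le p q).trans_lt hq)

/-- The circle has diameter 1/2, so every radius above `r i` covers it and continuity is no
condition. -/
theorem isContinuous_of_half_le {A : Type*} [TopologicalSpace A] {i : Fin 2} (hr : 1 / 2 ≤ r i)
    (f : A → UnitAddCircle) : (ofTopology A).IsContinuous
    (wedgeOfCirclesClosure (r 0) (r 1)) fun p => incl i (f p) := by
  rw [isContinuous_iff]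
  intro p ρ hρ
  refine Filter.Eventually.of_forall fun q => incl_mem_ball ?_
  have : (1 / 2 : ℝ) ≤ r i := by exact_mod_cast hr
  linarith [dist_le_half (f p) (f q), hρ i]

/-- The class of the image of the affine path from `s` to `t` in the `i`-th circle. -/
noncomputable def arc (r : Fin 2 → ℝ≥0) (i : Fin 2) {x y : WedgeOfCircles} (s t : ℝ)
    (hs : incl i s = x) (ht : incl i t = y) :
    (wedgeOfCirclesClosure (r 0) (r 1)).pt x ⟶ (wedgeOfCirclesClosure (r 0) (r 1)).pt y :=
  (Curve.ofReal (isContinuous_incl_coe i) s t hs ht).cls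

theorem arc_comp (i : Fin 2) {x y z : WedgeOfCircles} (s t u : ℝ) (hs : incl i s = x)
    (ht : incl i t = y) (hu : incl i u = z) :
    arc r i s t hs ht ≫ arc r i t u ht hu = arc r i s u hs hu :=
  Curve.cls_ofReal_comp _ _ _ _ _ _ _

theorem arc_self (i : Fin 2) {x : WedgeOfCircles} (s : ℝ) (hs : incl i s = x) :
    arc r i s s hs hs = 𝟙 _ :=
  Curve.cls_ofReal_self _ _ _

theorem inv_arc (i : Fin 2) {x y : WedgeOfCircles} (s t : ℝ) (hs : incl i s = x)
    (ht : incl i t = y) : CategoryTheory.inv (arc r i s t hs ht) = arc r i t s ht hs :=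
  Curve.inv_cls_ofReal _ _ _ _ _

theorem coe_add_intCast (s : ℝ) (n : ℤ) : ((s + n : ℝ) : UnitAddCircle) = s := by
  have : ((n : ℝ) : UnitAddCircle) = 0 := (AddCircle.coe_eq_zero_iff (1 : ℝ)).2 ⟨n, zsmul_one _⟩
  rw [AddCircle.coe_add, this, add_zero]

theorem arc_add_intCast (i : Fin 2) {x y : WedgeOfCircles} (s t : ℝ) (n : ℤ) (hs : incl i s = x)
    (ht : incl i t = y) (hs' : incl i ((s + n : ℝ) : UnitAddCircle) = x)
    (ht' : incl i ((t + n : ℝ) : UnitAddCircle) = y) :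
    arc r i (s + n) (t + n) hs' ht' = arc r i s t hs ht := by
  unfold arc
  congr 1
  unfold Curve.ofReal
  congr 1
  funext τ
  change incl i _ = incl i _
  rw [← coe_add_intCast (s + τ * (t - s)) n]
  congr 2
  ring

theorem incl_intCast (i : Fin 2) (n : ℤ) : incl i ((n : ℝ) : UnitAddCircle) = incl 0 0 := by
  have := coe_add_intCast 0 n
  rw [zero_add] at this
  rw [this, AddCircle.coe_zero]
  exact incl_zero i 0

/-- The class of the loop that runs once around the `i`-th circle. -/
noncomputable def loop (r : Fin 2 → ℝ≥0) (i : Fin 2) :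
    (wedgeOfCirclesClosure (r 0) (r 1)).FundamentalGroup (incl 0 0) :=
  FundamentalGroup.toHom.symm
    (arc r i ((0 : ℤ) : ℝ) ((1 : ℤ) : ℝ) (incl_intCast i 0) (incl_intCast i 1))

theorem toHom_loop (i : Fin 2) : FundamentalGroup.toHom (loop r i) =
    arc r i ((0 : ℤ) : ℝ) ((1 : ℤ) : ℝ) (incl_intCast i 0) (incl_intCast i 1) :=
  Equiv.apply_symm_apply _ _

/-- By periodicity, the arc from `n` to `n + 1` is the loop itself; concatenation handles positive
powers and cancellation negative ones. -/
theorem toHom_loop_zpow (i : Fin 2) (n : ℤ) : FundamentalGroup.toHom (loop r i ^ n) =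
    arc r i ((0 : ℤ) : ℝ) (n : ℝ) (incl_intCast i 0) (incl_intCast i n) := by
  have hstep (n : ℤ) : arc r i ((0 : ℤ) : ℝ) ((n + 1 : ℤ) : ℝ) (incl_intCast i 0)
      (incl_intCast i (n + 1)) = arc r i ((0 : ℤ) : ℝ) (n : ℝ) (incl_intCast i 0)
      (incl_intCast i n) ≫ FundamentalGroup.toHom (loop r i) := by
    have h0 : (((0 : ℤ) : ℝ) + n) = n := by simp
    have h1 : (((1 : ℤ) : ℝ) + n) = ((n + 1 : ℤ) : ℝ) := by push_cast; ring
    have h := arc_add_intCast (r := r) i ((0 : ℤ) : ℝ) ((1 : ℤ) : ℝ) n (incl_intCast i 0)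
      (incl_intCast i 1) (by rw [h0]; exact incl_intCast i n)
      (by rw [h1]; exact incl_intCast i (n + 1))
    simp only [h0, h1] at h
    rw [toHom_loop, ← h, arc_comp]
  induction n using Int.induction_on with
  | zero => rw [arc_self]; rfl
  | succ n ih => rw [zpow_add_one, FundamentalGroup.toHom_mul, ih, hstep]
  | pred n ih =>
    have h := hstep (-n - 1)
    have h' := FundamentalGroup.toHom_mul (loop r i ^ (-(n : ℤ) - 1)) (loop r i)
    rw [← zpow_add_one] at h'
    simp only [sub_add_cancel] at h h'
    rw [ih, h] at h'
    exact ((cancel_mono _).1 h').symm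

theorem loop_eq_one {i : Fin 2} (hr : 1 / 2 ≤ r i) : loop r i = 1 := by
  apply FundamentalGroup.toHom.injective
  rw [toHom_loop]
  change _ = (Curve.const _ _).cls
  rw [arc, Curve.cls_eq]
  classical
  -- The homotopy jumps to the constant loop immediately after time 0, which is continuous because
  -- any map into this circle is.
  refine ⟨fun p => incl i (if p.2 = 0 then ((p.1 : ℝ) : UnitAddCircle) else 0), ?_, ?_, ?_, ?_, ?_⟩
  · rw [isContinuous_prod_iff]
    exact isContinuous_of_half_le hr _
  · intro s
    simp [Curve.ofReal]
  · intro s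
    simp only [one_ne_zero, if_false]
    exact incl_zero i 0
  · intro t
    simp [incl_zero i 0]
  · intro t
    have := incl_intCast i 1
    rw [Int.cast_one] at this
    dsimp only
    split_ifs
    · exact this
    · exact incl_zero i 0

end WedgeOfCircles

/-! ### Contracting curves in a ball, and the computation -/

namespace WedgeOfCircles

open CechClosure UnitAddCircle CategoryTheory

variable {r : Fin 2 → ℝ≥0} {ρ : Fin 2 → ℝ} {G : Type*} [Group G] {a : Fin 2 → G}

open Classical in
/-- The point at parameter `t` of the arc from `y` to `x`, for `x` and `y` on a common circle. -/
noncomputable def contract (x y : WedgeOfCircles) (t : ℝ) : WedgeOfCircles :=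
  if h : ∃ i b c, incl i b = x ∧ incl i c = y then
    incl h.choose (h.choose_spec.choose + ((1 - t) *
      rep (h.choose_spec.choose_spec.choose - h.choose_spec.choose) : ℝ))
  else x

/-- The choices in `contract` are harmless: two circles can compete only if both points are the
wedge point, and then nothing moves. -/
theorem contract_incl (i : Fin 2) (b c : UnitAddCircle) (t : ℝ) :
    contract (incl i b) (incl i c) t = incl i (b + ((1 - t) * rep (c - b) : ℝ)) := by
  have h : ∃ j b' c', incl j b' = incl i b ∧ incl j c' = incl i c := ⟨i, b, c, rfl, rfl⟩
  rw [contract, dif_pos h]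
  obtain ⟨hb, hc⟩ := h.choose_spec.choose_spec.choose_spec
  generalize h.choose_spec.choose_spec.choose = c' at *
  generalize h.choose_spec.choose = b' at *
  generalize h.choose = j at *
  by_cases hi : j = i
  · subst hi
    rw [incl_injective j hb, incl_injective j hc]
  · obtain ⟨rfl, rfl⟩ := incl_eq_incl hi hb
    obtain ⟨rfl, rfl⟩ := incl_eq_incl hi hc
    simp only [sub_zero, rep_zero, mul_zero, AddCircle.coe_zero, add_zero]
    exact incl_zero _ _

theorem contract_zero {x y : WedgeOfCircles} (hy : y ∈ ball ρ x) : contract x y 0 = y := by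
  obtain ⟨i, b, c, rfl, rfl, -⟩ := hy
  rw [contract_incl, sub_zero, one_mul, coe_rep, add_sub_cancel]

theorem contract_one {x y : WedgeOfCircles} (hy : y ∈ ball ρ x) : contract x y 1 = x := by
  obtain ⟨i, b, c, rfl, rfl, -⟩ := hy
  rw [contract_incl, sub_self, zero_mul, AddCircle.coe_zero, add_zero]

theorem contract_self (x : WedgeOfCircles) (t : ℝ) : contract x x t = x := by
  obtain ⟨i, b, rfl⟩ := exists_incl x
  rw [contract_incl, sub_self, rep_zero, mul_zero, AddCircle.coe_zero, add_zero]

/-- On a small circle displacements from `x` add by `rep_add`, so scaling them by `1 - w` does not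
increase the distance between two values of `v`; only the variation of `w` adds to it. On a large
circle nothing needs proof. -/
theorem isContinuous_contract (hρ : ∀ i, r i < ρ i) (hr : ∀ i, ρ i ≤ 1 / 3 ∨ 1 / 2 ≤ r i)
    {A : Type*} [TopologicalSpace A] {x : WedgeOfCircles} {v : A → WedgeOfCircles}
    (hv : (ofTopology A).IsContinuous (wedgeOfCirclesClosure (r 0) (r 1)) v)
    (hvx : ∀ p, v p ∈ ball ρ x) {w : A → ℝ} (hw : Continuous w) (hw0 : ∀ p, 0 ≤ w p)
    (hw1 : ∀ p, w p ≤ 1) : (ofTopology A).IsContinuous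
      (wedgeOfCirclesClosure (r 0) (r 1)) fun p => contract x (v p) (w p) := by
  have hpos : ∀ i, 0 < ρ i := fun i => (r i).2.trans_lt (hρ i)
  rw [isContinuous_iff] at hv ⊢
  intro p ρ' hρ'
  -- The midpoint radius leaves `(ρ' i - r i) / 2` for the variation of `w`, and stays below `ρ i`
  -- so that `rep_add` applies.
  have hmid : ∀ i, r i < (r i + min (ρ' i) (ρ i)) / 2 := by
    intro i
    have := lt_min (hρ' i) (hρ i)
    linarith
  have hwp : ∀ᶠ q in 𝓝 p, ∀ i, |w q - w p| < (ρ' i - r i) / 2 := by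
    rw [Filter.eventually_all]
    intro i
    have := hw.continuousAt.eventually
      (Metric.ball_mem_nhds (w p) (ε := (ρ' i - r i) / 2) (by linarith [hρ' i]))
    simpa only [← Real.dist_eq] using this
  filter_upwards [hv p _ hmid, hwp] with q hq hwq
  obtain ⟨i, b, c, d, hx, hp, hq'⟩ := exists_common (hvx p) (hvx q) hq
  have hbc := hvx p
  have hbd := hvx q
  rw [← hp] at hq hbc ⊢
  rw [← hq'] at hq hbd ⊢
  rw [← hx] at hbc hbd ⊢
  rw [incl_mem_ball_iff hpos] at hbc hbd
  rw [incl_mem_ball_iff fun i => (r i).2.trans_lt (hmid i)] at hq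
  rw [contract_incl, contract_incl]
  apply incl_mem_ball
  rcases hr i with h | h
  · have hcd : dist c d < ρ i := by
      have := min_le_right (ρ' i) (ρ i)
      linarith [hρ i]
    have hrep : rep (d - b) = rep (c - b) + rep (d - c) := by
      rw [← rep_add, show c - b + (d - c) = d - b by abel]
      rw [dist_comm, dist_eq_norm] at hbc hbd hcd
      rw [show c - b + (d - c) = d - b by abel]
      linarith
    have hc : |rep (c - b)| ≤ 1 := by
      rw [abs_rep, ← dist_eq_norm, dist_comm]
      linarith
    have hd : |rep (d - c)| = dist c d := by rw [abs_rep, ← dist_eq_norm, dist_comm]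
    rw [dist_add_left]
    refine (dist_coe_le _ _).trans_lt ?_
    have e : (1 - w p) * rep (c - b) - (1 - w q) * rep (d - b) =
        (w q - w p) * rep (c - b) - (1 - w q) * rep (d - c) := by
      rw [hrep]
      ring
    rw [e]
    have h1 : |(w q - w p) * rep (c - b)| ≤ |w q - w p| := by
      rw [abs_mul]
      exact mul_le_of_le_one_right (abs_nonneg _) hc
    have h2 : |(1 - w q) * rep (d - c)| ≤ dist c d := by
      rw [abs_mul, hd, abs_of_nonneg (by linarith [hw1 q])]
      exact mul_le_of_le_one_left dist_nonneg (by linarith [hw0 q])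
    have := min_le_left (ρ' i) (ρ i)
    linarith [abs_sub ((w q - w p) * rep (c - b)) ((1 - w q) * rep (d - c)), hwq i]
  · have : (1 / 2 : ℝ) ≤ r i := by exact_mod_cast h
    exact (dist_le_half _ _).trans_lt (by linarith [hρ' i])

/-- The homotopy has two stages, chosen to fix both endpoints. First the point at parameter `s` is
pulled toward the start by the fraction `1 - s`; then the parameter is pushed on to 1 with that
fraction kept, leaving the end point contracted by `1 - s`, which traces the arc. -/
theorem cls_eq_arc (hρ : ∀ i, r i < ρ i) (hr : ∀ i, ρ i ≤ 1 / 3 ∨ 1 / 2 ≤ r i) {i : Fin 2}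
    {b c : UnitAddCircle}
    (u : Curve (wedgeOfCirclesClosure (r 0) (r 1)) (incl i b) (incl i c))
    (hu : ∀ t, u.toFun t ∈ ball ρ (incl i b)) :
    u.cls = arc r i (rep b) (rep b + rep (c - b)) (by rw [coe_rep]) (by simp) := by
  rw [arc, Curve.cls_eq]
  have hue : ∀ t, u.extend t ∈ ball ρ (incl i b) := fun t => hu _
  have hc : incl i c ∈ ball ρ (incl i b) := u.target ▸ hu 1
  refine ⟨fun p => contract (incl i b)
    (u.extend ((p.1 : ℝ) + max 0 (2 * (p.2 : ℝ) - 1) * (1 - p.1)))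
    (min 1 (2 * (p.2 : ℝ)) * (1 - p.1)), ?_, ?_, ?_, ?_, ?_⟩
  · rw [isContinuous_prod_iff]
    refine isContinuous_contract hρ hr (u.extend_cont.comp_continuous (by fun_prop))
      (fun p => hue _) (by fun_prop) (fun p => ?_) (fun p => ?_)
    · exact mul_nonneg (le_min zero_le_one (by linarith [p.2.2.1])) (by linarith [p.1.2.2])
    · exact mul_le_one₀ (min_le_left _ _) (by linarith [p.1.2.2]) (by linarith [p.1.2.1])
  · intro s
    simp only [Icc.coe_zero, mul_zero, zero_sub]
    rw [max_eq_left (by norm_num), min_eq_right (by norm_num), zero_mul, add_zero,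
      contract_zero (hue _), u.extend_coe]
  · intro s
    simp only [Icc.coe_one, mul_one]
    rw [max_eq_right (by norm_num), min_eq_left (by norm_num), u.extend_of_one_le (by linarith),
      contract_incl]
    change _ = incl i _
    congr 1
    rw [← coe_rep b, ← AddCircle.coe_add, coe_rep]
    congr 1
    ring
  · intro t
    simp only [Icc.coe_zero, sub_zero, mul_one, zero_add]
    rcases le_total (2 * (t : ℝ)) 1 with h | h
    · rw [max_eq_left (by linarith), u.extend_of_le_zero le_rfl, contract_self]
    · rw [min_eq_left h, contract_one (hue _)]
  · intro t
    simp only [Icc.coe_one, sub_self, mul_zero, add_zero]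
    rw [u.extend_of_one_le le_rfl, contract_zero hc]

theorem exists_arc_from_base (r : Fin 2 → ℝ≥0) (x : WedgeOfCircles) :
    ∃ γ : (wedgeOfCirclesClosure (r 0) (r 1)).pt (incl 0 0) ⟶
      (wedgeOfCirclesClosure (r 0) (r 1)).pt x,
      ∀ i b (hb : incl i b = x), γ = arc r i ((0 : ℤ) : ℝ) (rep b) (incl_intCast i 0)
        (by rw [coe_rep, hb]) := by
  obtain ⟨i, b, rfl⟩ := exists_incl x
  refine ⟨arc r i ((0 : ℤ) : ℝ) (rep b) (incl_intCast i 0) (by rw [coe_rep]), ?_⟩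
  intro j c hc
  by_cases hij : i = j
  · subst hij
    obtain rfl := incl_injective i hc
    rfl
  · obtain ⟨rfl, rfl⟩ := incl_eq_incl hij hc.symm
    -- At the wedge point both descriptions give a constant arc. Its end points are equal only
    -- propositionally, hence `eqToHom`.
    have key (k : Fin 2) (s : ℝ) (hs : s = 0) (y : WedgeOfCircles) (hy : y = incl 0 0) :
        ∀ h h', arc r k (x := incl 0 0) (y := y) ((0 : ℤ) : ℝ) s h h' = eqToHom (by rw [hy]) := by
      subst hs hy
      intro h h'
      simp only [Int.cast_zero]
      rw [arc_self]
      rfl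
    rw [key i _ rep_zero _ (incl_zero _ _), key j _ rep_zero _ (incl_zero _ _)]

/-- In the universal cover of the circle, go from `0` to `rep b`, then along the short arc to `rep c
+ wind b c`, then back by the returning arc translated by `wind b c`. The result runs from `0` to
`wind b c`. -/
theorem conj_cls_eq (hρ : ∀ i, r i < ρ i) (hr : ∀ i, ρ i ≤ 1 / 3 ∨ 1 / 2 ≤ r i)
    (ψ : G →* (wedgeOfCirclesClosure (r 0) (r 1)).FundamentalGroup (incl 0 0))
    (hψ : ∀ i, ψ (a i) = loop r i) {x y : WedgeOfCircles}
    (u : Curve (wedgeOfCirclesClosure (r 0) (r 1)) x y) (hu : ∀ t, u.toFun t ∈ ball ρ x) :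
    (exists_arc_from_base r x).choose ≫ u.cls ≫
      CategoryTheory.inv (exists_arc_from_base r y).choose =
      FundamentalGroup.toHom (ψ (transition a x y)) := by
  obtain ⟨i, b, c, rfl, rfl, -⟩ : y ∈ ball ρ x := u.target ▸ hu 1
  have hn : rep c + (wind b c : ℝ) = rep b + rep (c - b) := by
    rw [coe_wind]
    ring
  have h0 : ((0 : ℤ) : ℝ) + (wind b c : ℝ) = (wind b c : ℝ) := by simp
  have hs := arc_add_intCast (r := r) i (rep c) ((0 : ℤ) : ℝ) (wind b c)
    (x := incl i c) (y := incl 0 0) (by rw [coe_rep]) (incl_intCast i 0)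
    (by rw [coe_add_intCast, coe_rep]) (by rw [h0]; exact incl_intCast i _)
  simp only [hn, h0] at hs
  rw [transition_incl, map_zpow, hψ, toHom_loop_zpow,
    (exists_arc_from_base r _).choose_spec i b rfl, (exists_arc_from_base r _).choose_spec i c rfl,
    cls_eq_arc hρ hr u hu, inv_arc, ← hs, arc_comp, arc_comp]

theorem deg_loop (hφ : IsCocycle (wedgeOfCirclesClosure (r 0) (r 1)) (ball ρ) (transition a))
    (i : Fin 2) : hφ.deg (FundamentalGroup.toHom (loop r i)) = a i := by
  -- An explicit lift along the real line: `t - rep t` is an integer, and its increments over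
  -- distances below 1/2 are the winding numbers. It goes from 0 to 1 on the unit interval.
  let k : ℝ → ℤ := fun t => round (t - rep t)
  have hk (t : ℝ) : (k t : ℝ) = t - rep t := by
    obtain ⟨n, hn⟩ := exists_eq_add_intCast (s := t) (t := rep t) (by simp)
    have : t - rep t = n := by linarith
    simp only [k, this, round_intCast]
  have hg : IsLocalLift (fun s t : ℝ => transition a (incl i s) (incl i t)) fun t => a i ^ k t := by
    intro s
    filter_upwards [Metric.ball_mem_nhds s (by norm_num : (0 : ℝ) < 1 / 2)] with t ht
    rw [Metric.mem_ball, Real.dist_eq] at ht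
    rw [transition_incl, ← zpow_add]
    congr 1
    have : (k t : ℝ) = k s + wind s t := by
      rw [coe_wind, hk, hk, ← AddCircle.coe_sub, rep_coe ht]
      ring
    exact_mod_cast this
  rw [toHom_loop, arc, hφ.deg_cls, Curve.degree_eq hφ _
    (g := fun t => a i ^ k (projIcc (0 : ℝ) 1 zero_le_one t : ℝ))]
  · have h0 : k 0 = 0 := by
      have := hk 0
      rw [AddCircle.coe_zero, rep_zero, sub_zero] at this
      exact_mod_cast this
    have h1 : k 1 = 1 := by
      have := hk 1
      rw [AddCircle.coe_period, rep_zero, sub_zero] at this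
      exact_mod_cast this
    simp [h0, h1]
  · have := hg.comp (f := fun t : ℝ => (projIcc (0 : ℝ) 1 zero_le_one t : ℝ))
      (continuous_subtype_val.comp continuous_projIcc)
    simpa [Curve.extend, Curve.ofReal, IccExtend] using this

/-- The fundamental group of the wedge of two circles, given by two generators, those of the
circles with large parameter being trivial. -/
theorem nonempty_mulEquiv (hρ : ∀ i, r i < ρ i)
    (hr : ∀ i, ρ i ≤ 1 / 3 ∨ (1 / 2 ≤ r i ∧ a i = 1))
    (ψ : G →* (wedgeOfCirclesClosure (r 0) (r 1)).FundamentalGroup (incl 0 0))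
    (hψ : ∀ i, ψ (a i) = loop r i)
    (hgen : ∀ D : G →* G, (∀ i, D (a i) = a i) → D = MonoidHom.id G) (x : WedgeOfCircles) :
    Nonempty ((wedgeOfCirclesClosure (r 0) (r 1)).FundamentalGroup x ≃* G) := by
  have hφ := isCocycle_transition hρ fun i => (hr i).imp_right And.right
  refine hφ.nonempty_mulEquiv (fun x => (exists_arc_from_base r x).choose) ψ
    (fun x y u hu => conj_cls_eq hρ (fun i => (hr i).imp_right And.left) ψ hψ u hu) ?_ x
  -- Degree after `ψ` is an endomorphism of `G` fixing the generators, hence the identity.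
  let D : G →* G := MonoidHom.mk' (fun g => hφ.deg (FundamentalGroup.toHom (ψ g))) fun g g' => by
    rw [map_mul, FundamentalGroup.toHom_mul, hφ.deg_comp]
  exact fun g => DFunLike.congr_fun (hgen D fun i => by
    change hφ.deg (FundamentalGroup.toHom (ψ (a i))) = a i
    rw [hψ, deg_loop]) g

end WedgeOfCircles

open WedgeOfCircles in
theorem mainTheorem6 (r₁ r₂ : ℝ≥0) (x₀ : WedgeOfCircles) :
    (r₁ < 1 / 3 → r₂ < 1 / 3 →
      Nonempty ((wedgeOfCirclesClosure r₁ r₂).FundamentalGroup x₀ ≃* FreeGroup (Fin 2))) ∧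
    ((r₁ < 1 / 3 ∧ 1 / 2 ≤ r₂) ∨ (r₂ < 1 / 3 ∧ 1 / 2 ≤ r₁) →
      Nonempty ((wedgeOfCirclesClosure r₁ r₂).FundamentalGroup x₀ ≃* Multiplicative ℤ)) ∧
    (1 / 2 ≤ r₁ → 1 / 2 ≤ r₂ →
      Subsingleton ((wedgeOfCirclesClosure r₁ r₂).FundamentalGroup x₀)) := by
  have small {r : ℝ≥0} (h : r < 1 / 3) : (r : ℝ) < 1 / 3 := by exact_mod_cast h
  -- On a large circle any radius above `r` serves, since its generator is 1.
  have large (r : ℝ≥0) : (r : ℝ) < r + 1 := lt_add_one _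
  refine ⟨fun h₁ h₂ => ?_, ?_, fun h₁ h₂ => ?_⟩
  · refine nonempty_mulEquiv (r := ![r₁, r₂]) (ρ := fun _ => 1 / 3) (a := FreeGroup.of)
      (Fin.forall_fin_two.2 ⟨small h₁, small h₂⟩) (fun _ => Or.inl le_rfl)
      (FreeGroup.lift (loop ![r₁, r₂])) (fun i => FreeGroup.lift_apply_of) (fun D hD => ?_) x₀
    exact FreeGroup.ext_hom _ _ hD
  · rintro (⟨h₁, h₂⟩ | ⟨h₂, h₁⟩)
    · refine nonempty_mulEquiv (r := ![r₁, r₂]) (ρ := ![1 / 3, r₂ + 1])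
        (a := ![Multiplicative.ofAdd 1, 1])
        (Fin.forall_fin_two.2 ⟨small h₁, large r₂⟩)
        (Fin.forall_fin_two.2 ⟨Or.inl le_rfl, Or.inr ⟨h₂, rfl⟩⟩)
        (zpowersHom _ (loop ![r₁, r₂] 0)) (Fin.forall_fin_two.2 ⟨?_, ?_⟩) (fun D hD => ?_) x₀
      · exact zpow_one (loop ![r₁, r₂] 0)
      · rw [loop_eq_one (r := ![r₁, r₂]) (i := 1) h₂]
        exact map_one _
      · exact MonoidHom.ext_mint (hD 0)
    · refine nonempty_mulEquiv (r := ![r₁, r₂]) (ρ := ![r₁ + 1, 1 / 3])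
        (a := ![1, Multiplicative.ofAdd 1])
        (Fin.forall_fin_two.2 ⟨large r₁, small h₂⟩)
        (Fin.forall_fin_two.2 ⟨Or.inr ⟨h₁, rfl⟩, Or.inl le_rfl⟩)
        (zpowersHom _ (loop ![r₁, r₂] 1)) (Fin.forall_fin_two.2 ⟨?_, ?_⟩) (fun D hD => ?_) x₀
      · rw [loop_eq_one (r := ![r₁, r₂]) (i := 0) h₁]
        exact map_one _
      · exact zpow_one (loop ![r₁, r₂] 1)
      · exact MonoidHom.ext_mint (hD 1)
  · obtain ⟨e⟩ := nonempty_mulEquiv (r := ![r₁, r₂]) (ρ := ![r₁ + 1, r₂ + 1])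
      (a := fun _ => (1 : Unit)) (Fin.forall_fin_two.2 ⟨large r₁, large r₂⟩)
      (Fin.forall_fin_two.2 ⟨Or.inr ⟨h₁, rfl⟩, Or.inr ⟨h₂, rfl⟩⟩) 1
      (Fin.forall_fin_two.2 ⟨(loop_eq_one (r := ![r₁, r₂]) (i := 0) h₁).symm,
        (loop_eq_one (r := ![r₁, r₂]) (i := 1) h₂).symm⟩)
      (fun D _ => Subsingleton.elim _ _) x₀
    exact e.toEquiv.subsingleton
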